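/- Let $\Bbbk$ be an algebraically closed field of characteristic zero, $G$ a finite abelian group and $\Phi$ a normalized $3$-cocycle on $G$ with values in $\Bbbk^*$ (normalized means $\Phi(f,1,g)=1$ for all $f,g\in G$). Put $\widetilde\Phi_g(x,y)=\Phi(g,x,y)\Phi(x,y,g)\Phi(x,g,y)^{-1}$. Let ${}_{\Bbbk G}^{\Bbbk G}\mathcal{YD}^{\Phi}$ be the category of twisted Yetter–Drinfeld modules: $G$-graded vector spaces $V=\bigoplus_{g\in G}V_g$ with linear operators $e\triangleright(-)$, $e\in G$, which preserve every $V_g$ and satisfy $1\triangleright v=v$ and $e\triangleright(f\triangleright v)=\widetilde\Phi_g(e,f)\,(ef)\triangleright v$ for $v\in V_g$. For homogeneous $X,Y,Z$ of degrees $x,y,z$, its tensor product, associativity constraint and braiding are given by $e\triangleright(X\otimes Y)=\widetilde\Phi_e(x,y)(e\triangleright X)\otimes(e\triangleright Y)$, $(X\otimes Y)\otimes Z\mapsto\Phi(x,y,z)^{-1}X\otimes(Y\otimes Z)$ and $X\otimes Y\mapsto (x\triangleright Y)\otimes X$. The Nichols algebra $B(V)$ is the quotient of the tensor algebra $T_\Phi(V)$,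 a Hopf algebra in this category with $\Delta(X)=X\otimes 1+1\otimes X$ for $X\in V$, by its largest graded Hopf ideal generated by homogeneous elements of degree at least $2$. The object $V$, and $B(V)$, are of diagonal type if $V$ is a direct sum of $1$-dimensional objects; a $3$-cocycle is abelian if every simple twisted Yetter–Drinfeld module for it is $1$-dimensional. The support group $G_V$ is the subgroup of $G$ generated by all $g$ with $V_g\neq 0$. Let $V$ be an object of ${}_{\Bbbk G}^{\Bbbk G}\mathcal{YD}^{\Phi}$ which is simple or a direct sum of two simple objects, and let $H=G_V$ and $\Psi=\Phi|_{H}$. Then $\Psi$ is an abelian $3$-cocycle on $H$, and there is an object $V'$ of diagonal type in ${}_{\Bbbk H}^{\Bbbk H}\mathcal{YD}^{\Psi}$ such that $B(V)$ is isomorphic to $B(V')$. Here isomorphic means the following: $\dim V=\dim V'=l<\infty$; there are decompositions $V=\bigoplus_{i=1}^l L_i$ and $V'=\bigoplus_{i=1}^l L'_i$ into lines, each refining some decomposition of $V$, respectively $V'$, into simple objects, such that $B(V)$ and $B(V')$ are $\mathbb Z^l$-graded by $\deg L_i=\deg L'_i=e_i$; and there is a $\mathbb Z^l$-graded linear isomorphism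 $B(V)\to B(V')$ which preserves multiplication and comultiplication. -/

import Mathlib

open scoped TensorProduct

universe u w

noncomputable section

namespace QuasiNichols

attribute [local instance] Fintype.ofFinite

/-- A normalized `3`-cocycle on the group `G` with values in `kˣ`. -/
structure Cocycle3 (k : Type u) (G : Type w) [Field k] [CommGroup G] where
  toFun : G → G → G → kˣ
  cocycle : ∀ e f g h, toFun (e * f) g h * toFun e f (g * h) =
    toFun e f g * toFun e (f * g) h * toFun f g h
  normalized : ∀ f g, toFun f 1 g = 1

namespace Cocycle3

variable {k : Type u} {G : Type w} [Field k] [CommGroup G]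

instance : CoeFun (Cocycle3 k G) (fun _ => G → G → G → kˣ) := ⟨toFun⟩

/-- The `2`-cocycle `Φ̃_g (x, y) = Φ(g,x,y) Φ(x,y,g) / Φ(x,g,y)`. -/
def tilde (Φ : Cocycle3 k G) (g x y : G) : kˣ := Φ g x y * Φ x y g / Φ x g y

/-- The restriction `Φ|_H` of a cocycle to a subgroup. -/
def restrict (Φ : Cocycle3 k G) (H : Subgroup G) : Cocycle3 k H where
  toFun x y z := Φ x y z
  cocycle e f g h := by simpa using Φ.cocycle e f g h
  normalized f g := by simpa using Φ.normalized f g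

theorem one_left (Φ : Cocycle3 k G) (g h : G) : Φ 1 g h = 1 := by
  have h1 := Φ.cocycle 1 1 g h
  simp only [one_mul, Φ.normalized] at h1
  simpa using h1.symm

theorem one_right (Φ : Cocycle3 k G) (e f : G) : Φ e f 1 = 1 := by
  have h1 := Φ.cocycle e f 1 1
  simp only [mul_one, Φ.normalized] at h1
  simpa using h1

theorem tilde_one_left (Φ : Cocycle3 k G) (x y : G) : Φ.tilde 1 x y = 1 := by
  simp [tilde, one_left, one_right, Φ.normalized]

theorem tilde_mul (Φ : Cocycle3 k G) (e f g h : G) :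
    Φ.tilde e g h * Φ.tilde f g h * (Φ.tilde g e f * Φ.tilde h e f) =
      Φ.tilde (g * h) e f * Φ.tilde (e * f) g h := by
  have h1 := congrArg Additive.ofMul (Φ.cocycle e f g h)
  have h2 := congrArg Additive.ofMul (Φ.cocycle e g f h)
  have h3 := congrArg Additive.ofMul (Φ.cocycle e g h f)
  have h4 := congrArg Additive.ofMul (Φ.cocycle g e f h)
  have h5 := congrArg Additive.ofMul (Φ.cocycle g e h f)
  have h6 := congrArg Additive.ofMul (Φ.cocycle g h e f)
  apply Additive.ofMul.injective
  simp only [tilde, ofMul_mul, ofMul_div, mul_comm g e, mul_comm h e, mul_comm g f,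
    mul_comm h f] at *
  linear_combination (norm := abel) h2 - h1 - h3 - h4 + h5 - h6

end Cocycle3

variable {k : Type u} {G : Type w} [Field k] [CommGroup G] [Finite G]

/-- A twisted Yetter–Drinfeld module over `(kG, Φ)`.  The coaction is `δ(v) = ∑ g ⊗ comp g v`, that
is, `comp g` is the projection of `V = ⨁ V_g` onto the component `V_g`, and each `V_g` is a
projective representation of `G` with respect to the `2`-cocycle `Φ̃_g`. -/
structure TwistedYD (Φ : Cocycle3 k G) where
  carrier : Type u
  [addCommGroup : AddCommGroup carrier]
  [module : Module k carrier]
  comp : G → carrier →ₗ[k] carrier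
  comp_self : ∀ g v, comp g (comp g v) = comp g v
  comp_ne : ∀ g h v, g ≠ h → comp g (comp h v) = 0
  sum_comp : ∀ v, ∑ g, comp g v = v
  act : G → carrier →ₗ[k] carrier
  act_one : ∀ v, act 1 v = v
  comp_act : ∀ e g v, comp g (act e v) = act e (comp g v)
  act_act : ∀ e f g v, act e (act f (comp g v)) =
    (Φ.tilde g e f : k) • act (e * f) (comp g v)

namespace TwistedYD

attribute [instance] TwistedYD.addCommGroup TwistedYD.module

variable {Φ : Cocycle3 k G}

instance : CoeSort (TwistedYD Φ) (Type u) := ⟨carrier⟩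

/-! ### Subobjects, simple objects, diagonal type, support group -/

/-- A linear subspace which is a twisted Yetter–Drinfeld submodule. -/
def IsSub (V : TwistedYD Φ) (W : Submodule k V) : Prop :=
  (∀ g, ∀ x ∈ W, V.comp g x ∈ W) ∧ (∀ e, ∀ x ∈ W, V.act e x ∈ W)

/-- `W` is a simple twisted Yetter–Drinfeld submodule of `V`. -/
def IsSimpleSub (V : TwistedYD Φ) (W : Submodule k V) : Prop :=
  V.IsSub W ∧ W ≠ ⊥ ∧ ∀ W' : Submodule k V, V.IsSub W' → W' ≤ W → W' = ⊥ ∨ W' = W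

/-- `V` is a simple object. -/
def IsSimple (V : TwistedYD Φ) : Prop := V.IsSimpleSub ⊤

/-- `V` is the internal direct sum of the linear subspaces `L i`. -/
def IsDirectSum (V : TwistedYD Φ) {ι : Type*} (L : ι → Submodule k V) : Prop :=
  iSupIndep L ∧ iSup L = ⊤

/-- `V` is a direct sum of two simple objects. -/
def IsSumOfTwoSimples (V : TwistedYD Φ) : Prop :=
  ∃ S : Fin 2 → Submodule k V, V.IsDirectSum S ∧ ∀ i, V.IsSimpleSub (S i)

/-- `V` is of diagonal type: a direct sum of one-dimensional objects. -/
def IsDiagonal (V : TwistedYD Φ) : Prop :=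
  ∃ (ι : Type u) (L : ι → Submodule k V), V.IsDirectSum L ∧
    ∀ i, V.IsSub (L i) ∧ Module.finrank k (L i) = 1

/-- The support group `G_V`: the subgroup generated by the degrees `g` with `V_g ≠ 0`. -/
def supportGroup (V : TwistedYD Φ) : Subgroup G :=
  Subgroup.closure {g | V.comp g ≠ 0}

/-! ### The monoidal structure and the braiding -/

theorem comp_apply_comp [DecidableEq G] (V : TwistedYD Φ) (g h : G) (v : V) :
    V.comp g (V.comp h v) = if g = h then V.comp h v else 0 := by
  split_ifs with e
  · subst e; exact V.comp_self _ _
  · exact V.comp_ne _ _ _ e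

/-- The linear map on `V ⊗ W` which is `F g h` on `V_g ⊗ W_h`. -/
def onHomog (V W : TwistedYD Φ) {M : Type u} [AddCommGroup M] [Module k M]
    (F : G → G → (V ⊗[k] W →ₗ[k] M)) : V ⊗[k] W →ₗ[k] M :=
  ∑ g, ∑ h, F g h ∘ₗ TensorProduct.map (V.comp g) (W.comp h)

theorem onHomog_apply (V W : TwistedYD Φ) {M : Type u} [AddCommGroup M] [Module k M]
    (F : G → G → (V ⊗[k] W →ₗ[k] M)) (g h : G) (v : V) (w : W) :
    V.onHomog W F (V.comp g v ⊗ₜ W.comp h w) = F g h (V.comp g v ⊗ₜ W.comp h w) := by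
  classical
  simp only [onHomog, LinearMap.sum_apply, LinearMap.comp_apply, TensorProduct.map_tmul,
    comp_apply_comp]
  rw [Finset.sum_eq_single g, Finset.sum_eq_single h]
  · simp
  · intro b _ hb; simp [hb]
  · simp
  · intro b _ hb; simp [hb]
  · simp

theorem hom_ext_homog (V W : TwistedYD Φ) {M : Type u} [AddCommGroup M] [Module k M]
    {p q : V ⊗[k] W →ₗ[k] M}
    (hpq : ∀ g h v w, p (V.comp g v ⊗ₜ W.comp h w) = q (V.comp g v ⊗ₜ W.comp h w)) : p = q := by
  ext v w
  simp only [TensorProduct.AlgebraTensorModule.curry_apply, LinearMap.restrictScalars_self,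
    TensorProduct.curry_apply]
  rw [← V.sum_comp v, ← W.sum_comp w]
  simp only [TensorProduct.sum_tmul, TensorProduct.tmul_sum, map_sum, hpq]

/-- `(V ⊗ W)_x = ⨁_{g h = x} V_g ⊗ W_h`. -/
def tensorComp (V W : TwistedYD Φ) (x : G) : V ⊗[k] W →ₗ[k] V ⊗[k] W := by
  classical exact V.onHomog W fun g h => if g * h = x then LinearMap.id else 0

/-- `e ▷ (X ⊗ Y) = Φ̃_e(g,h) (e ▷ X) ⊗ (e ▷ Y)` for `X ∈ V_g`, `Y ∈ W_h`. -/
def tensorAct (V W : TwistedYD Φ) (e : G) : V ⊗[k] W →ₗ[k] V ⊗[k] W :=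
  V.onHomog W fun g h => (Φ.tilde e g h : k) • TensorProduct.map (V.act e) (W.act e)

theorem tensorComp_apply [DecidableEq G] (V W : TwistedYD Φ) (x g h : G) (v : V) (w : W) :
    V.tensorComp W x (V.comp g v ⊗ₜ W.comp h w) =
      if g * h = x then V.comp g v ⊗ₜ W.comp h w else 0 := by
  rw [tensorComp, onHomog_apply]
  split_ifs <;> simp

theorem tensorAct_apply (V W : TwistedYD Φ) (e g h : G) (v : V) (w : W) :
    V.tensorAct W e (V.comp g v ⊗ₜ W.comp h w) =
      (Φ.tilde e g h : k) • (V.comp g (V.act e v) ⊗ₜ W.comp h (W.act e w)) := by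
  rw [tensorAct, onHomog_apply]
  simp [V.comp_act, W.comp_act]

/-- The tensor product of twisted Yetter–Drinfeld modules. -/
@[reducible] def tensor (V W : TwistedYD Φ) : TwistedYD Φ where
  carrier := V ⊗[k] W
  comp := V.tensorComp W
  comp_self x := by
    classical
    refine LinearMap.congr_fun (f := (V.tensorComp W x) ∘ₗ (V.tensorComp W x)) ?_
    refine hom_ext_homog V W fun g h v w => ?_
    simp only [LinearMap.comp_apply, tensorComp_apply]
    split_ifs with h1
    · simp [tensorComp_apply, h1]
    · simp
  comp_ne x y z hxy := by
    classical
    revert z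
    refine LinearMap.congr_fun (f := (V.tensorComp W x) ∘ₗ (V.tensorComp W y)) (g := 0) ?_
    refine hom_ext_homog V W fun g h v w => ?_
    simp only [LinearMap.comp_apply, tensorComp_apply]
    split_ifs with h1
    · simp [tensorComp_apply, h1, hxy.symm]
    · simp
  sum_comp z := by
    classical
    have : ∑ x, V.tensorComp W x = LinearMap.id := by
      refine hom_ext_homog V W fun g h v w => ?_
      simp [LinearMap.sum_apply, tensorComp_apply]
    simpa [LinearMap.sum_apply] using LinearMap.congr_fun this z
  act := V.tensorAct W
  act_one := by
    refine LinearMap.congr_fun (g := LinearMap.id) ?_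
    refine hom_ext_homog V W fun g h v w => ?_
    simp [tensorAct_apply, Φ.tilde_one_left, V.act_one, W.act_one]
  comp_act e x := by
    classical
    refine LinearMap.congr_fun (f := (V.tensorComp W x) ∘ₗ (V.tensorAct W e))
      (g := (V.tensorAct W e) ∘ₗ (V.tensorComp W x)) ?_
    refine hom_ext_homog V W fun g h v w => ?_
    simp only [LinearMap.comp_apply, tensorComp_apply, tensorAct_apply, map_smul]
    split_ifs with h1 <;> simp [tensorAct_apply]
  act_act e f x := by
    classical
    refine LinearMap.congr_fun (f := (V.tensorAct W e) ∘ₗ (V.tensorAct W f) ∘ₗ (V.tensorComp W x))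
      (g := (Φ.tilde x e f : k) • ((V.tensorAct W (e * f)) ∘ₗ (V.tensorComp W x))) ?_
    refine hom_ext_homog V W fun g h v w => ?_
    simp only [LinearMap.comp_apply, tensorComp_apply, LinearMap.smul_apply]
    split_ifs with h1
    · subst h1
      rw [tensorAct_apply, LinearMap.map_smul, tensorAct_apply, tensorAct_apply]
      simp only [V.comp_act, W.comp_act, V.act_act, W.act_act, TensorProduct.smul_tmul,
        TensorProduct.tmul_smul, smul_smul]
      congr 1
      have := congrArg (Units.val) (Φ.tilde_mul e f g h)
      simp only [Units.val_mul] at this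
      linear_combination this
    · simp

/-- The unit object `k`, concentrated in degree `1` with trivial action. -/
@[reducible] def unit (Φ : Cocycle3 k G) : TwistedYD Φ where
  carrier := k
  comp g := by classical exact if g = 1 then LinearMap.id else 0
  comp_self g v := by split_ifs <;> simp
  comp_ne g h v hgh := by
    by_cases h1 : g = 1
    · have : h ≠ 1 := fun h2 => hgh (h1.trans h2.symm)
      simp [this]
    · simp [h1]
  sum_comp v := by
    classical
    rw [Finset.sum_eq_single 1]
    · simp
    · intro b _ hb; simp [hb]
    · simp
  act _ := LinearMap.id
  act_one _ := rfl
  comp_act _ _ _ := rfl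
  act_act e f g v := by
    by_cases h1 : g = 1
    · simp [h1, Φ.tilde_one_left]
    · simp [h1]

/-- The associativity constraint
`(X ⊗ Y) ⊗ Z ↦ Φ(e,f,g)⁻¹ X ⊗ (Y ⊗ Z)` for `X ∈ U_e`, `Y ∈ V_f`, `Z ∈ W_g`. -/
def assocHom (U V W : TwistedYD Φ) : (U ⊗[k] V) ⊗[k] W →ₗ[k] U ⊗[k] (V ⊗[k] W) :=
  ∑ e, ∑ f, ∑ g, (((Φ e f g)⁻¹ : kˣ) : k) •
    (TensorProduct.assoc k U V W).toLinearMap ∘ₗ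
      TensorProduct.map (TensorProduct.map (U.comp e) (V.comp f)) (W.comp g)

/-- The inverse of the associativity constraint. -/
def assocInv (U V W : TwistedYD Φ) : U ⊗[k] (V ⊗[k] W) →ₗ[k] (U ⊗[k] V) ⊗[k] W :=
  ∑ e, ∑ f, ∑ g, (Φ e f g : k) •
    (TensorProduct.assoc k U V W).symm.toLinearMap ∘ₗ
      TensorProduct.map (U.comp e) (TensorProduct.map (V.comp f) (W.comp g))

/-- The braiding `X ⊗ Y ↦ (g ▷ Y) ⊗ X` for `X ∈ V_g`. -/
def braiding (V W : TwistedYD Φ) : V ⊗[k] W →ₗ[k] W ⊗[k] V :=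
  ∑ g, (TensorProduct.comm k V W).toLinearMap ∘ₗ TensorProduct.map (V.comp g) (W.act g)

/-- The interchange `(A ⊗ B) ⊗ (C ⊗ D) → (A ⊗ C) ⊗ (B ⊗ D)` which braids `B` past `C`. -/
def interchange (A B C D : TwistedYD Φ) :
    (A ⊗[k] B) ⊗[k] (C ⊗[k] D) →ₗ[k] (A ⊗[k] C) ⊗[k] (B ⊗[k] D) :=
  assocInv A C (tensor B D) ∘ₗ
    TensorProduct.map LinearMap.id (assocHom C B D) ∘ₗ
      TensorProduct.map LinearMap.id (TensorProduct.map (braiding B C) LinearMap.id) ∘ₗ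
        TensorProduct.map LinearMap.id (assocInv B C D) ∘ₗ
          assocHom A B (tensor C D)

/-! ### The tensor algebra `T_Φ(V)` as a Hopf algebra in the braided category -/

/-- The left bracketed tensor power `(⋯((k ⊗ V) ⊗ V) ⊗ ⋯) ⊗ V`. -/
def tpow (V : TwistedYD Φ) : ℕ → TwistedYD Φ
  | 0 => unit Φ
  | n + 1 => tensor (tpow V n) V

/-- The multiplication `V^{⊗ n} ⊗ V^{⊗ m} → V^{⊗ (n + m)}`, which moves the brackets to the left by
means of the associativity constraint. -/
def mulPow (V : TwistedYD Φ) (n : ℕ) :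
    (m : ℕ) → V.tpow n ⊗[k] V.tpow m →ₗ[k] V.tpow (n + m)
  | 0 => (TensorProduct.rid k (V.tpow n)).toLinearMap
  | m + 1 => TensorProduct.map (mulPow V n m) LinearMap.id ∘ₗ assocInv (V.tpow n) (V.tpow m) V

/-- The object `T_Φ(V) = ⨁ n, V^{⊗ n}`. -/
@[reducible] def T (V : TwistedYD Φ) : TwistedYD Φ where
  carrier := DirectSum ℕ fun n => V.tpow n
  comp g := DirectSum.lmap fun n => (V.tpow n).comp g
  comp_self g x := by
    ext n; simp [DirectSum.lmap_apply, comp_self]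
  comp_ne g h x hgh := by
    ext n; simp [DirectSum.lmap_apply, comp_ne _ g h _ hgh]
  sum_comp x := by
    refine DFinsupp.ext fun n => ?_
    rw [DFinsupp.finsetSum_apply]
    exact (V.tpow n).sum_comp (x n)
  act e := DirectSum.lmap fun n => (V.tpow n).act e
  act_one x := by
    ext n; simp [DirectSum.lmap_apply, act_one]
  comp_act e g x := by
    ext n; simp [DirectSum.lmap_apply, comp_act]
  act_act e f g x := by
    refine DFinsupp.ext fun n => ?_
    rw [DirectSum.smul_apply]
    exact (V.tpow n).act_act e f g (x n)

/-- The inclusion of `V^{⊗ n}` in `T_Φ(V)`. -/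
def incl (V : TwistedYD Φ) (n : ℕ) : V.tpow n →ₗ[k] V.T :=
  DirectSum.lof k ℕ (fun n => V.tpow n) n

/-- The unit element of `T_Φ(V)`. -/
def one (V : TwistedYD Φ) : V.T := V.incl 0 (1 : k)

/-- The inclusion of `V = V^{⊗ 1}` in `T_Φ(V)`. -/
def ι (V : TwistedYD Φ) : V →ₗ[k] V.T :=
  V.incl 1 ∘ₗ (TensorProduct.lid k V).symm.toLinearMap

/-- The multiplication of `T_Φ(V)`. -/
def mul (V : TwistedYD Φ) : V.T ⊗[k] V.T →ₗ[k] V.T :=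
  TensorProduct.lift <| DirectSum.toModule k ℕ _ fun n =>
    LinearMap.flip <| DirectSum.toModule k ℕ _ fun m =>
      LinearMap.flip <| TensorProduct.curry <| V.incl (n + m) ∘ₗ V.mulPow n m

/-- The multiplication of the algebra `T_Φ(V) ⊗ T_Φ(V)` in the braided category. -/
def mul₂ (V : TwistedYD Φ) :
    (V.T ⊗[k] V.T) ⊗[k] (V.T ⊗[k] V.T) →ₗ[k] V.T ⊗[k] V.T :=
  TensorProduct.map V.mul V.mul ∘ₗ interchange V.T V.T V.T V.T

/-- `X ↦ X ⊗ 1 + 1 ⊗ X` on `V`. -/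
def primitive (V : TwistedYD Φ) : V →ₗ[k] V.T ⊗[k] V.T :=
  (TensorProduct.mk k V.T V.T).flip V.one ∘ₗ V.ι + TensorProduct.mk k V.T V.T V.one ∘ₗ V.ι

/-- The restriction of the comultiplication to `V^{⊗ n}`: it is the algebra map with
`Δ(X) = X ⊗ 1 + 1 ⊗ X` on `V`, so that `Δ(Y X) = Δ(Y) Δ(X)`. -/
def comulPow (V : TwistedYD Φ) : (n : ℕ) → V.tpow n →ₗ[k] V.T ⊗[k] V.T
  | 0 => LinearMap.toSpanSingleton k _ (V.one ⊗ₜ V.one)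
  | n + 1 => V.mul₂ ∘ₗ TensorProduct.map (comulPow V n) V.primitive

/-- The comultiplication of `T_Φ(V)`. -/
def comul (V : TwistedYD Φ) : V.T →ₗ[k] V.T ⊗[k] V.T :=
  DirectSum.toModule k ℕ _ V.comulPow

/-- The counit of `T_Φ(V)`, the projection onto the component of degree `0`. -/
def counit (V : TwistedYD Φ) : V.T →ₗ[k] k :=
  DirectSum.component k ℕ (fun n => V.tpow n) 0

/-- The restriction of the antipode to `V^{⊗ n}`: it is the braided anti-multiplicative map with
`S(X) = -X` on `V`. -/
def antipodePow (V : TwistedYD Φ) : (n : ℕ) → V.tpow n →ₗ[k] V.T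
  | 0 => V.incl 0
  | n + 1 => V.mul ∘ₗ braiding V.T V.T ∘ₗ TensorProduct.map (antipodePow V n) (-V.ι)

/-- The antipode of `T_Φ(V)`. -/
def antipode (V : TwistedYD Φ) : V.T →ₗ[k] V.T :=
  DirectSum.toModule k ℕ _ V.antipodePow

/-! ### The Nichols algebra -/

/-- The subspace `I ⊗ T + T ⊗ I` of `T ⊗ T`. -/
def coidealSpan (V : TwistedYD Φ) (I : Submodule k V.T) : Submodule k (V.T ⊗[k] V.T) :=
  LinearMap.range (TensorProduct.map I.subtype (LinearMap.id : V.T →ₗ[k] V.T)) ⊔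
    LinearMap.range (TensorProduct.map (LinearMap.id : V.T →ₗ[k] V.T) I.subtype)

/-- `I` is an `ℕ`-graded Hopf ideal of `T_Φ(V)` (in the category of twisted Yetter–Drinfeld modules)
which is generated by homogeneous elements of degree at least `2`. -/
structure IsGradedHopfIdeal (V : TwistedYD Φ) (I : Submodule k V.T) : Prop where
  isSub : V.T.IsSub I
  graded : ∀ x ∈ I, ∀ n, V.incl n (x n) ∈ I
  degree_zero : ∀ x ∈ I, x 0 = 0
  degree_one : ∀ x ∈ I, x 1 = 0
  mul_right : ∀ x ∈ I, ∀ y, V.mul (x ⊗ₜ y) ∈ I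
  mul_left : ∀ x ∈ I, ∀ y, V.mul (y ⊗ₜ x) ∈ I
  comul : ∀ x ∈ I, V.comul x ∈ V.coidealSpan I
  counit : ∀ x ∈ I, V.counit x = 0
  antipode : ∀ x ∈ I, V.antipode x ∈ I

/-- The largest graded Hopf ideal of `T_Φ(V)` in degrees at least `2`. -/
def nicholsIdeal (V : TwistedYD Φ) : Submodule k V.T :=
  sSup {I | V.IsGradedHopfIdeal I}

theorem coidealSpan_mono (V : TwistedYD Φ) {I J : Submodule k V.T} (h : I ≤ J) :
    V.coidealSpan I ≤ V.coidealSpan J := by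
  refine sup_le_sup ?_ ?_
  · rintro _ ⟨z, rfl⟩
    refine ⟨TensorProduct.map (Submodule.inclusion h) LinearMap.id z, ?_⟩
    rw [← LinearMap.comp_apply, ← TensorProduct.map_comp]
    rfl
  · rintro _ ⟨z, rfl⟩
    refine ⟨TensorProduct.map LinearMap.id (Submodule.inclusion h) z, ?_⟩
    rw [← LinearMap.comp_apply, ← TensorProduct.map_comp]
    rfl

theorem nicholsIdeal_le (V : TwistedYD Φ) (S : Submodule k V.T)
    (h : ∀ I, V.IsGradedHopfIdeal I → I ≤ S) : V.nicholsIdeal ≤ S :=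
  sSup_le h

theorem le_nicholsIdeal (V : TwistedYD Φ) {I : Submodule k V.T} (h : V.IsGradedHopfIdeal I) :
    I ≤ V.nicholsIdeal :=
  le_sSup h

/-- The largest graded Hopf ideal in degrees at least `2` exists. -/
theorem nicholsIdeal_isGradedHopfIdeal (V : TwistedYD Φ) :
    V.IsGradedHopfIdeal V.nicholsIdeal where
  isSub := ⟨fun g => V.nicholsIdeal_le (V.nicholsIdeal.comap (V.T.comp g))
      fun _ hI x hx => V.le_nicholsIdeal hI (hI.isSub.1 g x hx),
    fun e => V.nicholsIdeal_le (V.nicholsIdeal.comap (V.T.act e))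
      fun _ hI x hx => V.le_nicholsIdeal hI (hI.isSub.2 e x hx)⟩
  graded _ hx n := V.nicholsIdeal_le (V.nicholsIdeal.comap
      (V.incl n ∘ₗ DirectSum.component k ℕ (fun n => V.tpow n) n))
      (fun _ hI x hx => V.le_nicholsIdeal hI (hI.graded x hx n)) hx
  degree_zero := V.nicholsIdeal_le (LinearMap.ker (DirectSum.component k ℕ (fun n => V.tpow n) 0))
      fun _ hI _ hx => hI.degree_zero _ hx
  degree_one := V.nicholsIdeal_le (LinearMap.ker (DirectSum.component k ℕ (fun n => V.tpow n) 1))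
      fun _ hI _ hx => hI.degree_one _ hx
  mul_right _ hx y := V.nicholsIdeal_le (V.nicholsIdeal.comap
      (V.mul ∘ₗ (TensorProduct.mk k V.T V.T).flip y))
      (fun _ hI x hx => V.le_nicholsIdeal hI (hI.mul_right x hx y)) hx
  mul_left _ hx y := V.nicholsIdeal_le (V.nicholsIdeal.comap
      (V.mul ∘ₗ TensorProduct.mk k V.T V.T y))
      (fun _ hI x hx => V.le_nicholsIdeal hI (hI.mul_left x hx y)) hx
  comul := V.nicholsIdeal_le ((V.coidealSpan V.nicholsIdeal).comap V.comul)
      fun _ hI x hx => V.coidealSpan_mono (V.le_nicholsIdeal hI) (hI.comul x hx)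
  counit := V.nicholsIdeal_le (LinearMap.ker V.counit) fun _ hI => hI.counit
  antipode := V.nicholsIdeal_le (V.nicholsIdeal.comap V.antipode)
      fun _ hI x hx => V.le_nicholsIdeal hI (hI.antipode x hx)

/-- The Nichols algebra `B(V) = T_Φ(V) / I`. -/
abbrev Nichols (V : TwistedYD Φ) : Type u := V.T ⧸ V.nicholsIdeal

/-- The multiplication of `B(V)`, induced by that of `T_Φ(V)`. -/
def nicholsMul (V : TwistedYD Φ) : V.Nichols →ₗ[k] V.Nichols →ₗ[k] V.Nichols :=
  V.nicholsIdeal.liftQ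
    (LinearMap.flip (V.nicholsIdeal.liftQ
      (LinearMap.flip ((TensorProduct.curry V.mul).compr₂ V.nicholsIdeal.mkQ))
      fun y hy => LinearMap.ext fun x => (Submodule.Quotient.mk_eq_zero _).2
        (V.nicholsIdeal_isGradedHopfIdeal.mul_left y hy x)))
    fun x hx => LinearMap.ext fun y => by
      obtain ⟨y, rfl⟩ := V.nicholsIdeal.mkQ_surjective y
      exact (Submodule.Quotient.mk_eq_zero _).2
        (V.nicholsIdeal_isGradedHopfIdeal.mul_right x hx y)

theorem nicholsMul_mkQ (V : TwistedYD Φ) (x y : V.T) :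
    V.nicholsMul (V.nicholsIdeal.mkQ x) (V.nicholsIdeal.mkQ y) =
      V.nicholsIdeal.mkQ (V.mul (x ⊗ₜ y)) := rfl

theorem coidealSpan_le_ker (V : TwistedYD Φ) (I : Submodule k V.T) :
    V.coidealSpan I ≤ LinearMap.ker (TensorProduct.map I.mkQ I.mkQ) := by
  refine sup_le ?_ ?_
  · rintro _ ⟨z, rfl⟩
    rw [LinearMap.mem_ker, ← LinearMap.comp_apply, ← TensorProduct.map_comp]
    have h : I.mkQ ∘ₗ I.subtype = 0 := LinearMap.ext fun x => by simp
    rw [LinearMap.comp_id, h, TensorProduct.map_zero_left, LinearMap.zero_apply]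
  · rintro _ ⟨z, rfl⟩
    rw [LinearMap.mem_ker, ← LinearMap.comp_apply, ← TensorProduct.map_comp]
    have h : I.mkQ ∘ₗ I.subtype = 0 := LinearMap.ext fun x => by simp
    rw [LinearMap.comp_id, h, TensorProduct.map_zero_right, LinearMap.zero_apply]

/-- The comultiplication of `B(V)`, induced by that of `T_Φ(V)`. -/
def nicholsComul (V : TwistedYD Φ) : V.Nichols →ₗ[k] V.Nichols ⊗[k] V.Nichols :=
  V.nicholsIdeal.liftQ
    (TensorProduct.map V.nicholsIdeal.mkQ V.nicholsIdeal.mkQ ∘ₗ V.comul)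
    fun x hx => V.coidealSpan_le_ker _ (V.nicholsIdeal_isGradedHopfIdeal.comul x hx)

theorem nicholsComul_mkQ (V : TwistedYD Φ) (x : V.T) :
    V.nicholsComul (V.nicholsIdeal.mkQ x) =
      TensorProduct.map V.nicholsIdeal.mkQ V.nicholsIdeal.mkQ (V.comul x) := rfl

/-! ### Multidegrees and isomorphisms of Nichols algebras -/

/-- The component of `V^{⊗ n}` of degree `d` for the `ℤ^l`-grading with `deg (L i) = e_i`. -/
def multiPow (V : TwistedYD Φ) {l : ℕ} (L : Fin l → Submodule k V) :
    (n : ℕ) → (Fin l → ℤ) → Submodule k (V.tpow n)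
  | 0, d => ⨆ _ : d = 0, ⊤
  | n + 1, d => ⨆ i, Submodule.map₂ (TensorProduct.mk k (V.tpow n) V)
      (multiPow V L n (d - Pi.single i 1)) (L i)

/-- The component of degree `d` of `B(V)` for the `ℤ^l`-grading with `deg (L i) = e_i`: the image of
the component of degree `d` of `T_Φ(V)`. -/
def nicholsDegree (V : TwistedYD Φ) {l : ℕ} (L : Fin l → Submodule k V) (d : Fin l → ℤ) :
    Submodule k V.Nichols :=
  (⨆ n, (V.multiPow L n d).map (V.incl n)).map V.nicholsIdeal.mkQ

/-- `V` is the direct sum of the lines `L i`, and each of the lines lies in a summand of a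
decomposition of `V` as a direct sum of simple objects.  If these summands are one-dimensional,
they are the lines themselves. -/
def IsLineDecomposition (V : TwistedYD Φ) {l : ℕ} (L : Fin l → Submodule k V) : Prop :=
  V.IsDirectSum L ∧ (∀ i, Module.finrank k (L i) = 1) ∧
    ∃ (m : ℕ) (S : Fin m → Submodule k V), V.IsDirectSum S ∧ (∀ j, V.IsSimpleSub (S j)) ∧
      ∀ i, ∃ j, L i ≤ S j

/-- `B(V)` is `ℤ^l`-graded by `deg (L i) = e_i`. -/
def IsNicholsGraded (V : TwistedYD Φ) {l : ℕ} (L : Fin l → Submodule k V) : Prop :=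
  iSupIndep (V.nicholsDegree L) ∧ ⨆ d, V.nicholsDegree L d = ⊤

/-- The Nichols algebras `B(V)` and `B(U)`, which may have different base groups, are isomorphic:
`dim V = dim U = l` and there is a `ℤ^l`-graded linear isomorphism `B(V) → B(U)` which preserves the
multiplication and the comultiplication. -/
def NicholsIso {H : Type*} [CommGroup H] [Finite H] {Ψ : Cocycle3 k H}
    (V : TwistedYD Φ) (U : TwistedYD Ψ) : Prop :=
  ∃ (l : ℕ) (L : Fin l → Submodule k V) (M : Fin l → Submodule k U),
    V.IsLineDecomposition L ∧ U.IsLineDecomposition M ∧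
    V.IsNicholsGraded L ∧ U.IsNicholsGraded M ∧
    ∃ F : V.Nichols ≃ₗ[k] U.Nichols,
      (∀ x y, F (V.nicholsMul x y) = U.nicholsMul (F x) (F y)) ∧
      (∀ x, U.nicholsComul (F x) =
        TensorProduct.map F.toLinearMap F.toLinearMap (V.nicholsComul x)) ∧
      ∀ d, (V.nicholsDegree L d).map F.toLinearMap = U.nicholsDegree M d

end TwistedYD

/-- `Φ` is an abelian `3`-cocycle: each simple twisted Yetter–Drinfeld module over `(kG, Φ)` is
one-dimensional. -/
def Cocycle3.IsAbelian (Φ : Cocycle3 k G) : Prop :=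
  ∀ V : TwistedYD Φ, V.IsSimple → Module.finrank k V = 1

end QuasiNichols

end

set_option linter.unusedSectionVars false

noncomputable section

namespace QuasiNichols

attribute [local instance] Fintype.ofFinite

/-! ### The commutators of the `2`-cocycles `Φ̃_g` -/

namespace Cocycle3

variable {k : Type u} {G : Type w} [Field k] [CommGroup G]

/-! A simple object lives in one degree, so the support group `H` of a sum of at most two simple
objects is generated by at most two elements. The commutator `Φ.alt x y z` of `Φ̃_x` is an
alternating trimultiplicative function, and such a function is trivial on a group with two
generators (`alt_eq_one`). So the `Φ̃_g` are symmetric on `H`, the operators of `H` commute on each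
homogeneous component, and, being of finite order up to scalars in characteristic zero, they are
simultaneously diagonalizable. This makes the restricted cocycle abelian (`isAbelian_of_tilde_comm`)
and gives a basis of homogeneous joint eigenvectors for `H` (`exists_eigenbasis`). The object `V'`
is `V` itself with the action of `H` only.

The product, coproduct and antipode of `T_Φ(V)` use the action only through degrees, which lie in
`H`; the identity of `V` therefore induces an isomorphism of tensor algebras. The Nichols ideals
need an argument, since ideals over `G` must be stable under `G`, those over `H` only under `H`. The
gap closes because all structure maps are morphisms: the sum of the `G`-translates of a Hopf ideal
that is only graded by `G` is again a Hopf ideal (`IsColinearHopfIdeal.translates`), so stability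
costs nothing and the ideals correspond (`nicholsIdeal_map`).

For the `ℤ^l`-grading of `B(V')`, the automorphism of `V'` which scales the `i`-th eigenvector by
the `i`-th prime acts on multidegree `d` by `∏ p_i ^ d_i`. These scalars are distinct by unique
factorization, so the multidegrees are independent (`isNicholsGraded_of_basis`). The grading is then
carried back to `B(V)`. -/

theorem tilde_one_right (Φ : Cocycle3 k G) (g x : G) : Φ.tilde g x 1 = 1 := by
  simp [tilde, one_right, Φ.normalized]

theorem tilde_one_mid (Φ : Cocycle3 k G) (g x : G) : Φ.tilde g 1 x = 1 := by
  simp [tilde, one_left, Φ.normalized]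

/-- `Φ̃_e` is a `2`-cocycle. -/
theorem tilde_cocycle (Φ : Cocycle3 k G) (e x y z : G) :
    Φ.tilde e x (y * z) * Φ.tilde e y z = Φ.tilde e (x * y) z * Φ.tilde e x y := by
  -- The alternating product of the `3`-cocycle identities over the four positions of `e` among `x,
  -- y, z`.
  have h1 := congrArg Additive.ofMul (Φ.cocycle e x y z)
  have h2 := congrArg Additive.ofMul (Φ.cocycle x e y z)
  have h3 := congrArg Additive.ofMul (Φ.cocycle x y e z)
  have h4 := congrArg Additive.ofMul (Φ.cocycle x y z e)
  apply Additive.ofMul.injective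
  simp only [tilde, ofMul_mul, ofMul_div, mul_comm x e, mul_comm y e, mul_comm z e] at *
  linear_combination (norm := abel) h1 - h2 + h3 - h4

/-- The commutator `Φ̃_x (y, z) / Φ̃_x (z, y)` of the `2`-cocycle `Φ̃_x`. -/
def alt (Φ : Cocycle3 k G) (x y z : G) : kˣ := Φ.tilde x y z / Φ.tilde x z y

/-- Written out, `Φ.alt x y z` is the product of the values of `Φ` at the six permutations of `x, y,
z`, with exponents the signs; a rotation is even. -/
theorem alt_rotate (Φ : Cocycle3 k G) (x y z : G) : Φ.alt x y z = Φ.alt y z x := by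
  apply Additive.ofMul.injective
  simp only [alt, tilde, ofMul_mul, ofMul_div]
  abel

theorem alt_self (Φ : Cocycle3 k G) (x z : G) : Φ.alt z x x = 1 := by
  simp [alt]

theorem alt_one (Φ : Cocycle3 k G) (x y : G) : Φ.alt x y 1 = 1 := by
  simp [alt, tilde_one_right, tilde_one_mid]

/-- The commutator of a `2`-cocycle on an abelian group is a bicharacter: compare the cocycle
identities for the three positions of `y` relative to `z, z'`. With `alt_rotate` this gives
multiplicativity in every variable. -/
theorem alt_mul (Φ : Cocycle3 k G) (x y z z' : G) :
    Φ.alt x y (z * z') = Φ.alt x y z * Φ.alt x y z' := by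
  have h1 := congrArg Additive.ofMul (Φ.tilde_cocycle x y z z')
  have h2 := congrArg Additive.ofMul (Φ.tilde_cocycle x z y z')
  have h3 := congrArg Additive.ofMul (Φ.tilde_cocycle x z z' y)
  apply Additive.ofMul.injective
  simp only [alt, ofMul_mul, ofMul_div, mul_comm z y, mul_comm z' y] at *
  linear_combination (norm := abel) h1 - h2 + h3

/-- For fixed `x` and `y`, the commutator of `Φ̃_x` is a character. -/
def altHom (Φ : Cocycle3 k G) (x y : G) : G →* kˣ where
  toFun := Φ.alt x y
  map_one' := Φ.alt_one x y
  map_mul' := Φ.alt_mul x y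

theorem alt_eq_one_of_closure (Φ : Cocycle3 k G) {S : Set G} {x y : G}
    (h : ∀ z ∈ S, Φ.alt x y z = 1) {z : G} (hz : z ∈ Subgroup.closure S) : Φ.alt x y z = 1 :=
  (Subgroup.closure_le (Φ.altHom x y).ker).2 h hz

/-- The alternating trilinear map `Φ.alt` vanishes on a subgroup generated by two elements. -/
theorem alt_eq_one (Φ : Cocycle3 k G) {a b x y z : G} (hx : x ∈ Subgroup.closure {a, b})
    (hy : y ∈ Subgroup.closure {a, b}) (hz : z ∈ Subgroup.closure {a, b}) :
    Φ.alt x y z = 1 := by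
  -- Each variable is rotated into the last slot in turn and reduced to the generators there.
  refine Φ.alt_eq_one_of_closure (fun z hz => ?_) hz
  rw [← Φ.alt_rotate]
  refine Φ.alt_eq_one_of_closure (fun y hy => ?_) hy
  rw [← Φ.alt_rotate]
  refine Φ.alt_eq_one_of_closure (fun x hx => ?_) hx
  -- Of three elements of `{a, b}` two coincide, wherever they stand.
  have key : ∀ p q : G, Φ.alt p q p = 1 := fun p q => by
    rw [Φ.alt_rotate, Φ.alt_self]
  have key' : ∀ p q : G, Φ.alt p p q = 1 := fun p q => by
    rw [Φ.alt_rotate, key]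
  rcases hx with rfl | rfl <;> rcases hy with rfl | rfl <;> rcases hz with rfl | rfl <;>
    simp [key, key', alt_self]

theorem tilde_comm_of_alt (Φ : Cocycle3 k G) {x y z : G} (h : Φ.alt x y z = 1) :
    Φ.tilde x y z = Φ.tilde x z y := div_eq_one.1 h

/-- The identity which makes the braiding a morphism. -/
theorem tilde_braiding (Φ : Cocycle3 k G) (e x y : G) :
    Φ.tilde e x y * Φ.tilde y x e = Φ.tilde e y x * Φ.tilde y e x := by
  apply Additive.ofMul.injective
  simp only [tilde, ofMul_mul, ofMul_div]
  abel

end Cocycle3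

variable {k : Type u} {G : Type w} [Field k] [CommGroup G] [Finite G]

namespace TwistedYD

variable {Φ : Cocycle3 k G}

/-! ### Evaluation on homogeneous elements -/

theorem hom_ext_homog₃ (U V W : TwistedYD Φ) {M : Type u} [AddCommGroup M] [Module k M]
    {p q : U ⊗[k] (V ⊗[k] W) →ₗ[k] M}
    (hpq : ∀ e f g u v w, p (U.comp e u ⊗ₜ (V.comp f v ⊗ₜ W.comp g w)) =
      q (U.comp e u ⊗ₜ (V.comp f v ⊗ₜ W.comp g w))) : p = q := by
  refine TensorProduct.ext' fun u z => ?_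
  rw [← U.sum_comp u]
  simp only [TensorProduct.sum_tmul, map_sum]
  refine Finset.sum_congr rfl fun e _ => ?_
  refine LinearMap.congr_fun (f := p ∘ₗ TensorProduct.mk k _ _ (U.comp e u))
    (g := q ∘ₗ TensorProduct.mk k _ _ (U.comp e u)) ?_ z
  exact hom_ext_homog V W fun f g v w => hpq e f g u v w

theorem hom_ext_homog₃' (U V W : TwistedYD Φ) {M : Type u} [AddCommGroup M] [Module k M]
    {p q : (U ⊗[k] V) ⊗[k] W →ₗ[k] M}
    (hpq : ∀ e f g u v w, p ((U.comp e u ⊗ₜ V.comp f v) ⊗ₜ W.comp g w) =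
      q ((U.comp e u ⊗ₜ V.comp f v) ⊗ₜ W.comp g w)) : p = q := by
  refine TensorProduct.ext' fun z w => ?_
  rw [← W.sum_comp w]
  simp only [TensorProduct.tmul_sum, map_sum]
  refine Finset.sum_congr rfl fun g _ => ?_
  refine LinearMap.congr_fun (f := p ∘ₗ (TensorProduct.mk k _ _).flip (W.comp g w))
    (g := q ∘ₗ (TensorProduct.mk k _ _).flip (W.comp g w)) ?_ z
  exact hom_ext_homog U V fun e f u v => hpq e f g u v w

/-- Here `V.comp g v` plays the generic vector of degree `g`. The lemma collapses the sums over
degrees in the associativity constraint and the braiding. -/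
theorem sum_eq_homog (V : TwistedYD Φ) {M : Type*} [AddCommGroup M] (g : G) (v : V) (F : G → V → M)
    (hF : ∀ h, F h 0 = 0) : ∑ h, F h (V.comp h (V.comp g v)) = F g (V.comp g v) := by
  rw [Finset.sum_eq_single g]
  · rw [V.comp_self]
  · intro h _ hne; rw [V.comp_ne _ _ _ hne, hF]
  · simp

theorem assocHom_apply (U V W : TwistedYD Φ) (e f g : G) (u : U) (v : V) (w : W) :
    assocHom U V W ((U.comp e u ⊗ₜ V.comp f v) ⊗ₜ W.comp g w) =
      (((Φ e f g)⁻¹ : kˣ) : k) • (U.comp e u ⊗ₜ (V.comp f v ⊗ₜ W.comp g w)) := by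
  simp only [assocHom, LinearMap.sum_apply, LinearMap.smul_apply, LinearMap.comp_apply,
    TensorProduct.map_tmul, LinearEquiv.coe_coe, TensorProduct.assoc_tmul]
  rw [U.sum_eq_homog e u fun e' u' => ∑ f', ∑ g', (((Φ e' f' g')⁻¹ : kˣ) : k) •
      (u' ⊗ₜ[k] (V.comp f' (V.comp f v) ⊗ₜ[k] W.comp g' (W.comp g w))),
    V.sum_eq_homog f v fun f' v' => ∑ g', (((Φ e f' g')⁻¹ : kˣ) : k) •
      (U.comp e u ⊗ₜ[k] (v' ⊗ₜ[k] W.comp g' (W.comp g w))),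
    W.sum_eq_homog g w fun g' w' => (((Φ e f g')⁻¹ : kˣ) : k) •
      (U.comp e u ⊗ₜ[k] (V.comp f v ⊗ₜ[k] w'))] <;> simp

theorem assocInv_apply (U V W : TwistedYD Φ) (e f g : G) (u : U) (v : V) (w : W) :
    assocInv U V W (U.comp e u ⊗ₜ (V.comp f v ⊗ₜ W.comp g w)) =
      (Φ e f g : k) • ((U.comp e u ⊗ₜ V.comp f v) ⊗ₜ W.comp g w) := by
  simp only [assocInv, LinearMap.sum_apply, LinearMap.smul_apply, LinearMap.comp_apply,
    TensorProduct.map_tmul, LinearEquiv.coe_coe, TensorProduct.assoc_symm_tmul]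
  rw [U.sum_eq_homog e u fun e' u' => ∑ f', ∑ g', (Φ e' f' g' : k) •
      ((u' ⊗ₜ[k] V.comp f' (V.comp f v)) ⊗ₜ[k] W.comp g' (W.comp g w)),
    V.sum_eq_homog f v fun f' v' => ∑ g', (Φ e f' g' : k) •
      ((U.comp e u ⊗ₜ[k] v') ⊗ₜ[k] W.comp g' (W.comp g w)),
    W.sum_eq_homog g w fun g' w' => (Φ e f g' : k) •
      ((U.comp e u ⊗ₜ[k] V.comp f v) ⊗ₜ[k] w')] <;> simp

theorem braiding_apply (V W : TwistedYD Φ) (g : G) (v : V) (w : W) :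
    braiding V W (V.comp g v ⊗ₜ w) = W.act g w ⊗ₜ V.comp g v := by
  simp only [braiding, LinearMap.sum_apply, LinearMap.comp_apply,
    TensorProduct.map_tmul, LinearEquiv.coe_coe, TensorProduct.comm_tmul]
  rw [V.sum_eq_homog g v fun g' v' => W.act g' w ⊗ₜ[k] v'] ; simp

/-! ### Maps which are compatible with a change of the group -/

/-- `Ψ` is the pullback of `Φ` along the injective homomorphism `j`. -/
structure IsPullback {H : Type*} [CommGroup H] (j : H →* G) (Φ : Cocycle3 k G)
    (Ψ : Cocycle3 k H) : Prop where
  inj : Function.Injective j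
  eq : ∀ x y z, Ψ x y z = Φ (j x) (j y) (j z)

theorem IsPullback.id (Φ : Cocycle3 k G) : IsPullback (MonoidHom.id G) Φ Φ :=
  ⟨fun _ _ h => h, fun _ _ _ => rfl⟩

/-- `f` is compatible with the coactions and the actions along `j`. -/
structure IsRes {H : Type*} [CommGroup H] [Finite H] (j : H →* G) {Ψ : Cocycle3 k H}
    (X : TwistedYD Φ) (Y : TwistedYD Ψ) (f : X →ₗ[k] Y) : Prop where
  comp : ∀ h x, f (X.comp (j h) x) = Y.comp h (f x)
  supp : ∀ g, g ∉ j.range → ∀ x, f (X.comp g x) = 0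
  act : ∀ h x, f (X.act (j h) x) = Y.act h (f x)

section IsRes

variable {H : Type*} [CommGroup H] [Finite H] {j : H →* G} {Ψ : Cocycle3 k H}

theorem IsPullback.tilde (hj : IsPullback j Φ Ψ) (x y z : H) :
    Ψ.tilde x y z = Φ.tilde (j x) (j y) (j z) := by
  simp [Cocycle3.tilde, hj.eq]

variable {X₁ X₂ X₃ X₄ : TwistedYD Φ} {Y₁ Y₂ Y₃ Y₄ : TwistedYD Ψ}
  {f₁ : X₁ →ₗ[k] Y₁} {f₂ : X₂ →ₗ[k] Y₂} {f₃ : X₃ →ₗ[k] Y₃} {f₄ : X₄ →ₗ[k] Y₄}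

/-- The case split behind the naturality proofs: vectors of degree outside the image of `j` are
killed, and for the other degrees the scalars on the two sides agree because `Ψ` is pulled back from
`Φ`. -/
theorem IsRes.cases (h₁ : IsRes j X₁ Y₁ f₁) (g : G) :
    (∀ x, f₁ (X₁.comp g x) = 0) ∨ ∃ h, j h = g := by
  by_cases hg : g ∈ j.range
  · exact Or.inr hg
  · exact Or.inl (h₁.supp g hg)

theorem IsRes.tensor (hj : IsPullback j Φ Ψ) (h₁ : IsRes j X₁ Y₁ f₁) (h₂ : IsRes j X₂ Y₂ f₂) :
    IsRes j (X₁.tensor X₂) (Y₁.tensor Y₂) (TensorProduct.map f₁ f₂) where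
  comp h := by
    classical
    refine LinearMap.congr_fun (f := TensorProduct.map f₁ f₂ ∘ₗ X₁.tensorComp X₂ (j h))
      (g := Y₁.tensorComp Y₂ h ∘ₗ TensorProduct.map f₁ f₂) ?_
    refine hom_ext_homog X₁ X₂ fun a b x y => ?_
    simp only [LinearMap.comp_apply, tensorComp_apply]
    rcases h₁.cases a with ha | ⟨a, rfl⟩
    · split_ifs <;> simp [ha]
    rcases h₂.cases b with hb | ⟨b, rfl⟩
    · split_ifs <;> simp [hb]
    -- Injectivity of `j` makes the degree conditions `j (a * b) = j h` and `a * b = h` equivalent.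
    simp only [TensorProduct.map_tmul, h₁.comp, h₂.comp, tensorComp_apply, ← map_mul, hj.inj.eq_iff]
    split_ifs <;> simp [h₁.comp, h₂.comp]
  supp g hg := by
    classical
    refine LinearMap.congr_fun (f := TensorProduct.map f₁ f₂ ∘ₗ X₁.tensorComp X₂ g)
      (g := 0) ?_
    refine hom_ext_homog X₁ X₂ fun a b x y => ?_
    simp only [LinearMap.comp_apply, tensorComp_apply]
    rcases h₁.cases a with ha | ⟨a, rfl⟩
    · split_ifs <;> simp [ha]
    rcases h₂.cases b with hb | ⟨b, rfl⟩
    · split_ifs <;> simp [hb]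
    rw [if_neg fun h => hg ⟨a * b, by simpa using h⟩]
    simp
  act h := by
    refine LinearMap.congr_fun (f := TensorProduct.map f₁ f₂ ∘ₗ X₁.tensorAct X₂ (j h))
      (g := Y₁.tensorAct Y₂ h ∘ₗ TensorProduct.map f₁ f₂) ?_
    refine hom_ext_homog X₁ X₂ fun a b x y => ?_
    simp only [LinearMap.comp_apply, tensorAct_apply]
    rcases h₁.cases a with ha | ⟨a, rfl⟩
    · simp [ha]
    rcases h₂.cases b with hb | ⟨b, rfl⟩
    · simp [hb]
    simp only [TensorProduct.map_tmul, h₁.comp, h₂.comp, tensorAct_apply, map_smul, h₁.act, h₂.act,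
      hj.tilde]

theorem assocHom_naturality (hj : IsPullback j Φ Ψ) (h₁ : IsRes j X₁ Y₁ f₁)
    (h₂ : IsRes j X₂ Y₂ f₂) (h₃ : IsRes j X₃ Y₃ f₃) :
    assocHom Y₁ Y₂ Y₃ ∘ₗ TensorProduct.map (TensorProduct.map f₁ f₂) f₃ =
      TensorProduct.map f₁ (TensorProduct.map f₂ f₃) ∘ₗ assocHom X₁ X₂ X₃ := by
  refine hom_ext_homog₃' X₁ X₂ X₃ fun a b c x y z => ?_
  simp only [LinearMap.comp_apply, assocHom_apply, map_smul, TensorProduct.map_tmul]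
  rcases h₁.cases a with ha | ⟨a, rfl⟩
  · simp [ha]
  rcases h₂.cases b with hb | ⟨b, rfl⟩
  · simp [hb]
  rcases h₃.cases c with hc | ⟨c, rfl⟩
  · simp [hc]
  simp only [h₁.comp, h₂.comp, h₃.comp, assocHom_apply, hj.eq]

theorem assocInv_naturality (hj : IsPullback j Φ Ψ) (h₁ : IsRes j X₁ Y₁ f₁)
    (h₂ : IsRes j X₂ Y₂ f₂) (h₃ : IsRes j X₃ Y₃ f₃) :
    assocInv Y₁ Y₂ Y₃ ∘ₗ TensorProduct.map f₁ (TensorProduct.map f₂ f₃) =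
      TensorProduct.map (TensorProduct.map f₁ f₂) f₃ ∘ₗ assocInv X₁ X₂ X₃ := by
  refine hom_ext_homog₃ X₁ X₂ X₃ fun a b c x y z => ?_
  simp only [LinearMap.comp_apply, assocInv_apply, map_smul, TensorProduct.map_tmul]
  rcases h₁.cases a with ha | ⟨a, rfl⟩
  · simp [ha]
  rcases h₂.cases b with hb | ⟨b, rfl⟩
  · simp [hb]
  rcases h₃.cases c with hc | ⟨c, rfl⟩
  · simp [hc]
  simp only [h₁.comp, h₂.comp, h₃.comp, assocInv_apply, hj.eq]

/-- Only the degree of the first factor acts in the braiding, so elements of `G` outside the image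
of `j` make no contribution. This is why the larger group is invisible to the Hopf structure. -/
theorem braiding_naturality (h₁ : IsRes j X₁ Y₁ f₁) (h₂ : IsRes j X₂ Y₂ f₂) :
    braiding Y₁ Y₂ ∘ₗ TensorProduct.map f₁ f₂ = TensorProduct.map f₂ f₁ ∘ₗ braiding X₁ X₂ := by
  refine hom_ext_homog X₁ X₂ fun a b x y => ?_
  simp only [LinearMap.comp_apply, braiding_apply, TensorProduct.map_tmul]
  rcases h₁.cases a with ha | ⟨a, rfl⟩
  · simp [ha]
  simp only [h₁.comp, braiding_apply, h₂.act]

theorem interchange_naturality (hj : IsPullback j Φ Ψ) (h₁ : IsRes j X₁ Y₁ f₁)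
    (h₂ : IsRes j X₂ Y₂ f₂) (h₃ : IsRes j X₃ Y₃ f₃) (h₄ : IsRes j X₄ Y₄ f₄) :
    interchange Y₁ Y₂ Y₃ Y₄ ∘ₗ
        TensorProduct.map (TensorProduct.map f₁ f₂) (TensorProduct.map f₃ f₄) =
      TensorProduct.map (TensorProduct.map f₁ f₃) (TensorProduct.map f₂ f₄) ∘ₗ
        interchange X₁ X₂ X₃ X₄ := by
  have e₁ := assocHom_naturality hj h₁ h₂ (h₃.tensor hj h₄)
  have e₂ := assocInv_naturality hj h₂ h₃ h₄
  have e₃ := braiding_naturality h₂ h₃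
  have e₄ := assocHom_naturality hj h₃ h₂ h₄
  have e₅ := assocInv_naturality hj h₁ h₃ (h₂.tensor hj h₄)
  have m₁ : TensorProduct.map LinearMap.id (assocInv Y₂ Y₃ Y₄) ∘ₗ
      TensorProduct.map f₁ (TensorProduct.map f₂ (TensorProduct.map f₃ f₄)) =
      TensorProduct.map f₁ (TensorProduct.map (TensorProduct.map f₂ f₃) f₄) ∘ₗ
      TensorProduct.map LinearMap.id (assocInv X₂ X₃ X₄) := by
    rw [← TensorProduct.map_comp, ← TensorProduct.map_comp, e₂, LinearMap.id_comp,
      LinearMap.comp_id]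
  have m₂ : TensorProduct.map LinearMap.id (TensorProduct.map (braiding Y₂ Y₃) LinearMap.id) ∘ₗ
      TensorProduct.map f₁ (TensorProduct.map (TensorProduct.map f₂ f₃) f₄) =
      TensorProduct.map f₁ (TensorProduct.map (TensorProduct.map f₃ f₂) f₄) ∘ₗ
      TensorProduct.map LinearMap.id (TensorProduct.map (braiding X₂ X₃) LinearMap.id) := by
    simp only [← TensorProduct.map_comp, e₃, LinearMap.id_comp, LinearMap.comp_id]
  have m₃ : TensorProduct.map LinearMap.id (assocHom Y₃ Y₂ Y₄) ∘ₗ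
      TensorProduct.map f₁ (TensorProduct.map (TensorProduct.map f₃ f₂) f₄) =
      TensorProduct.map f₁ (TensorProduct.map f₃ (TensorProduct.map f₂ f₄)) ∘ₗ
      TensorProduct.map LinearMap.id (assocHom X₃ X₂ X₄) := by
    rw [← TensorProduct.map_comp, ← TensorProduct.map_comp, e₄, LinearMap.id_comp,
      LinearMap.comp_id]
  refine LinearMap.ext fun z => ?_
  have e₁' := LinearMap.congr_fun e₁ z
  simp only [interchange, LinearMap.comp_apply] at e₁' ⊢
  rw [e₁', ← LinearMap.comp_apply (TensorProduct.map _ (assocInv Y₂ Y₃ Y₄)), m₁,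
    LinearMap.comp_apply,
    ← LinearMap.comp_apply (TensorProduct.map _ (TensorProduct.map (braiding Y₂ Y₃) _)), m₂,
    LinearMap.comp_apply, ← LinearMap.comp_apply (TensorProduct.map _ (assocHom Y₃ Y₂ Y₄)), m₃,
    LinearMap.comp_apply]
  exact LinearMap.congr_fun e₅ _

end IsRes

/-! ### The action of linear maps on the tensor algebra -/

theorem T_hom_ext (X : TwistedYD Φ) {M : Type*} [AddCommGroup M] [Module k M]
    {p q : X.T →ₗ[k] M} (h : ∀ n, p ∘ₗ X.incl n = q ∘ₗ X.incl n) : p = q :=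
  DirectSum.linearMap_ext k h

theorem TT_hom_ext (X : TwistedYD Φ) {M : Type*} [AddCommGroup M] [Module k M]
    {p q : X.T ⊗[k] X.T →ₗ[k] M}
    (h : ∀ n m, p ∘ₗ TensorProduct.map (X.incl n) (X.incl m) =
      q ∘ₗ TensorProduct.map (X.incl n) (X.incl m)) : p = q := by
  refine TensorProduct.ext (X.T_hom_ext fun n => LinearMap.ext fun x => X.T_hom_ext fun m =>
    LinearMap.ext fun y => ?_)
  exact LinearMap.congr_fun (h n m) (x ⊗ₜ y)

theorem mul_incl (X : TwistedYD Φ) (n m : ℕ) :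
    X.mul ∘ₗ TensorProduct.map (X.incl n) (X.incl m) = X.incl (n + m) ∘ₗ X.mulPow n m := by
  refine TensorProduct.ext' fun x y => ?_
  simp [mul, incl]

theorem comul_incl (X : TwistedYD Φ) (n : ℕ) : X.comul ∘ₗ X.incl n = X.comulPow n := by
  refine LinearMap.ext fun x => ?_
  simp [comul, incl]

theorem antipode_incl (X : TwistedYD Φ) (n : ℕ) : X.antipode ∘ₗ X.incl n = X.antipodePow n := by
  refine LinearMap.ext fun x => ?_
  simp [antipode, incl]

/-- The unit map of `T_Φ(V)`. -/
def unitMap (X : TwistedYD Φ) : k →ₗ[k] X.T := X.incl 0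

/-- In this form naturality and the morphism property can be checked factor by factor;
`comulPow_zero` serves the same purpose. -/
theorem primitive_eq (X : TwistedYD Φ) :
    X.primitive = TensorProduct.map X.ι X.unitMap ∘ₗ (TensorProduct.rid k X).symm.toLinearMap +
      TensorProduct.map X.unitMap X.ι ∘ₗ (TensorProduct.lid k X).symm.toLinearMap := by
  exact LinearMap.ext fun x => rfl

theorem comulPow_zero (X : TwistedYD Φ) :
    X.comulPow 0 = TensorProduct.map X.unitMap X.unitMap ∘ₗ
      (TensorProduct.lid k k).symm.toLinearMap := by
  refine LinearMap.ext_ring ?_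
  exact LinearMap.toSpanSingleton_apply_one k _ _

section Functor

variable {H : Type*} [CommGroup H] [Finite H] {Ψ : Cocycle3 k H}
  {K : Type*} [CommGroup K] [Finite K] {Θ : Cocycle3 k K}

/-- The `n`-th tensor power of a linear map. -/
def tpowMap {X : TwistedYD Φ} {Y : TwistedYD Ψ} (f : X →ₗ[k] Y) : (n : ℕ) → X.tpow n →ₗ[k] Y.tpow n
  | 0 => LinearMap.id (M := k)
  | n + 1 => TensorProduct.map (tpowMap f n) f

theorem tpowMap_comp {X : TwistedYD Φ} {Y : TwistedYD Ψ} {Z : TwistedYD Θ} (g : Y →ₗ[k] Z)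
    (f : X →ₗ[k] Y) (n : ℕ) : tpowMap (g ∘ₗ f) n = tpowMap g n ∘ₗ tpowMap f n := by
  induction n with
  | zero => rfl
  | succ n ih =>
    simp only [tpowMap]
    rw [ih]
    exact TensorProduct.map_comp _ _ _ _

theorem tpowMap_id (X : TwistedYD Φ) (n : ℕ) :
    tpowMap (X := X) (Y := X) LinearMap.id n = LinearMap.id := by
  induction n with
  | zero => rfl
  | succ n ih =>
    simp only [tpowMap]
    rw [ih]
    exact TensorProduct.map_id

/-- The map of tensor algebras induced by a linear map. -/
def TMap {X : TwistedYD Φ} {Y : TwistedYD Ψ} (f : X →ₗ[k] Y) : X.T →ₗ[k] Y.T :=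
  DirectSum.lmap fun n => tpowMap f n

theorem TMap_incl {X : TwistedYD Φ} {Y : TwistedYD Ψ} (f : X →ₗ[k] Y) (n : ℕ) :
    TMap f ∘ₗ X.incl n = Y.incl n ∘ₗ tpowMap f n := by
  refine LinearMap.ext fun x => ?_
  simp [TMap, incl]

theorem TMap_apply {X : TwistedYD Φ} {Y : TwistedYD Ψ} (f : X →ₗ[k] Y) (x : X.T) (n : ℕ) :
    TMap f x n = tpowMap f n (x n) := by
  simp [TMap, DirectSum.lmap_apply]

theorem TMap_comp {X : TwistedYD Φ} {Y : TwistedYD Ψ} {Z : TwistedYD Θ} (g : Y →ₗ[k] Z)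
    (f : X →ₗ[k] Y) : TMap (g ∘ₗ f) = TMap g ∘ₗ TMap f := by
  refine X.T_hom_ext fun n => ?_
  rw [TMap_incl, LinearMap.comp_assoc, TMap_incl, ← LinearMap.comp_assoc, TMap_incl, tpowMap_comp,
    LinearMap.comp_assoc]

theorem TMap_id (X : TwistedYD Φ) : TMap (X := X) (Y := X) LinearMap.id = LinearMap.id := by
  refine X.T_hom_ext fun n => ?_
  rw [TMap_incl, tpowMap_id, LinearMap.id_comp, LinearMap.comp_id]

/-- The isomorphism of tensor algebras induced by a linear isomorphism. -/
def TEquiv {X : TwistedYD Φ} {Y : TwistedYD Ψ} (f : X ≃ₗ[k] Y) : X.T ≃ₗ[k] Y.T :=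
  LinearEquiv.ofLinearMap (TMap f.toLinearMap) (TMap f.symm.toLinearMap)
    (by rw [← TMap_comp, f.comp_symm, TMap_id])
    (by rw [← TMap_comp, f.symm_comp, TMap_id])

variable {j : H →* G} {X : TwistedYD Φ} {Y : TwistedYD Ψ} {f : X →ₗ[k] Y}

theorem isRes_unit (hj : IsPullback j Φ Ψ) :
    IsRes j (unit Φ) (unit Ψ) (LinearMap.id (R := k) (M := k)) where
  comp h x := by
    have : j h = 1 ↔ h = 1 := by rw [← map_one j, hj.inj.eq_iff]
    by_cases h1 : h = 1 <;> simp [this, h1]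
  supp g hg x := by
    have : g ≠ 1 := fun h => hg (h ▸ one_mem _)
    simp [this]
  act _ _ := rfl

theorem IsRes.tpowMap (hj : IsPullback j Φ Ψ) (hf : IsRes j X Y f) (n : ℕ) :
    IsRes j (X.tpow n) (Y.tpow n) (tpowMap f n) := by
  induction n with
  | zero => exact isRes_unit hj
  | succ n ih => exact ih.tensor hj hf

theorem IsRes.TMap (hj : IsPullback j Φ Ψ) (hf : IsRes j X Y f) : IsRes j X.T Y.T (TMap f) where
  comp h x := by
    refine DFinsupp.ext fun n => ?_
    rw [TMap_apply]
    simp only [DirectSum.lmap_apply]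
    rw [TMap_apply]
    exact (hf.tpowMap hj n).comp h (x n)
  supp g hg x := by
    refine DFinsupp.ext fun n => ?_
    rw [TMap_apply]
    simp only [DirectSum.lmap_apply]
    exact (hf.tpowMap hj n).supp g hg (x n)
  act h x := by
    refine DFinsupp.ext fun n => ?_
    rw [TMap_apply]
    simp only [DirectSum.lmap_apply]
    rw [TMap_apply]
    exact (hf.tpowMap hj n).act h (x n)

theorem mulPow_naturality (hj : IsPullback j Φ Ψ) (hf : IsRes j X Y f) (n m : ℕ) :
    Y.mulPow n m ∘ₗ TensorProduct.map (tpowMap f n) (tpowMap f m) =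
      tpowMap f (n + m) ∘ₗ X.mulPow n m := by
  induction m with
  | zero =>
    refine TensorProduct.ext' fun x y => ?_
    exact ((tpowMap f n).map_smul y x).symm
  | succ m ih =>
    have h := assocInv_naturality hj (hf.tpowMap hj n) (hf.tpowMap hj m) hf
    refine LinearMap.ext fun (z : X.tpow n ⊗[k] (X.tpow m ⊗[k] X)) => ?_
    have h1 := congrArg (TensorProduct.map (Y.mulPow n m) LinearMap.id) (LinearMap.congr_fun h z)
    refine h1.trans ?_
    change _ = (TensorProduct.map (tpowMap f (n + m)) f) (TensorProduct.map (X.mulPow n m) LinearMap.id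
      (assocInv (X.tpow n) (X.tpow m) X z))
    rw [LinearMap.comp_apply, ← LinearMap.comp_apply (TensorProduct.map (Y.mulPow n m) _),
      ← LinearMap.comp_apply (TensorProduct.map (tpowMap f (n + m)) f),
      ← TensorProduct.map_comp, ← TensorProduct.map_comp, ih]
    rfl

theorem mul_naturality (hj : IsPullback j Φ Ψ) (hf : IsRes j X Y f) :
    Y.mul ∘ₗ TensorProduct.map (TMap f) (TMap f) = TMap f ∘ₗ X.mul := by
  refine X.TT_hom_ext fun n m => ?_
  rw [LinearMap.comp_assoc, ← TensorProduct.map_comp, TMap_incl, TMap_incl, TensorProduct.map_comp,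
    ← LinearMap.comp_assoc, mul_incl, LinearMap.comp_assoc, mulPow_naturality hj hf,
    LinearMap.comp_assoc, mul_incl, ← LinearMap.comp_assoc, ← LinearMap.comp_assoc, TMap_incl]

theorem mul₂_naturality (hj : IsPullback j Φ Ψ) (hf : IsRes j X Y f) :
    Y.mul₂ ∘ₗ TensorProduct.map (TensorProduct.map (TMap f) (TMap f))
        (TensorProduct.map (TMap f) (TMap f)) =
      TensorProduct.map (TMap f) (TMap f) ∘ₗ X.mul₂ := by
  have h := hf.TMap hj
  rw [mul₂, LinearMap.comp_assoc, interchange_naturality hj h h h h, ← LinearMap.comp_assoc,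
    ← TensorProduct.map_comp, mul_naturality hj hf, TensorProduct.map_comp, LinearMap.comp_assoc]
  rfl

theorem TMap_unitMap (f : X →ₗ[k] Y) : TMap f ∘ₗ X.unitMap = Y.unitMap :=
  TMap_incl f 0

theorem ι_naturality (f : X →ₗ[k] Y) : TMap f ∘ₗ X.ι = Y.ι ∘ₗ f := by
  refine LinearMap.ext fun x => ?_
  exact LinearMap.congr_fun (TMap_incl f 1) ((1 : k) ⊗ₜ[k] x)

theorem primitive_naturality (f : X →ₗ[k] Y) :
    TensorProduct.map (TMap f) (TMap f) ∘ₗ X.primitive = Y.primitive ∘ₗ f := by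
  have h1 := fun x => LinearMap.congr_fun (ι_naturality f) x
  have h2 := fun x => LinearMap.congr_fun (TMap_unitMap f) x
  simp only [LinearMap.comp_apply] at h1 h2
  refine LinearMap.ext fun x => ?_
  simp [primitive_eq, h1, h2]

theorem comulPow_naturality (hj : IsPullback j Φ Ψ) (hf : IsRes j X Y f) (n : ℕ) :
    Y.comulPow n ∘ₗ tpowMap f n = TensorProduct.map (TMap f) (TMap f) ∘ₗ X.comulPow n := by
  induction n with
  | zero =>
    have h : TensorProduct.map (TMap f) (TMap f) ∘ₗ TensorProduct.map X.unitMap X.unitMap =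
        TensorProduct.map Y.unitMap Y.unitMap := by
      rw [← TensorProduct.map_comp, TMap_unitMap]
    rw [comulPow_zero, comulPow_zero]
    exact (congrArg (fun p => p ∘ₗ (TensorProduct.lid k k).symm.toLinearMap) h).symm
  | succ n ih =>
    change (Y.mul₂ ∘ₗ TensorProduct.map (Y.comulPow n) Y.primitive) ∘ₗ
      TensorProduct.map (tpowMap f n) f = TensorProduct.map (TMap f) (TMap f) ∘ₗ
        (X.mul₂ ∘ₗ TensorProduct.map (X.comulPow n) X.primitive)
    rw [LinearMap.comp_assoc, ← TensorProduct.map_comp, ih, ← primitive_naturality,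
      TensorProduct.map_comp, ← LinearMap.comp_assoc, mul₂_naturality hj hf, LinearMap.comp_assoc]

theorem comul_naturality (hj : IsPullback j Φ Ψ) (hf : IsRes j X Y f) :
    Y.comul ∘ₗ TMap f = TensorProduct.map (TMap f) (TMap f) ∘ₗ X.comul := by
  refine X.T_hom_ext fun n => ?_
  rw [LinearMap.comp_assoc, TMap_incl, ← LinearMap.comp_assoc, comul_incl,
    comulPow_naturality hj hf, LinearMap.comp_assoc, comul_incl]

theorem antipodePow_naturality (hj : IsPullback j Φ Ψ) (hf : IsRes j X Y f) (n : ℕ) :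
    Y.antipodePow n ∘ₗ tpowMap f n = TMap f ∘ₗ X.antipodePow n := by
  induction n with
  | zero => exact (TMap_incl f 0).symm
  | succ n ih =>
    have h := hf.TMap hj
    change (Y.mul ∘ₗ braiding Y.T Y.T ∘ₗ TensorProduct.map (Y.antipodePow n) (-Y.ι)) ∘ₗ
      TensorProduct.map (tpowMap f n) f = TMap f ∘ₗ
        (X.mul ∘ₗ braiding X.T X.T ∘ₗ TensorProduct.map (X.antipodePow n) (-X.ι))
    have e : (-Y.ι) ∘ₗ f = TMap f ∘ₗ (-X.ι) := by
      rw [LinearMap.neg_comp, LinearMap.comp_neg, ι_naturality]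
    rw [LinearMap.comp_assoc, LinearMap.comp_assoc, ← TensorProduct.map_comp, ih, e,
      TensorProduct.map_comp, ← LinearMap.comp_assoc _ _ (braiding Y.T Y.T),
      braiding_naturality h h, LinearMap.comp_assoc, ← LinearMap.comp_assoc, mul_naturality hj hf,
      LinearMap.comp_assoc]

theorem antipode_naturality (hj : IsPullback j Φ Ψ) (hf : IsRes j X Y f) :
    Y.antipode ∘ₗ TMap f = TMap f ∘ₗ X.antipode := by
  refine X.T_hom_ext fun n => ?_
  rw [LinearMap.comp_assoc, TMap_incl, ← LinearMap.comp_assoc, antipode_incl,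
    antipodePow_naturality hj hf, LinearMap.comp_assoc, antipode_incl]

end Functor

/-! ### The structure maps are morphisms -/

/-- `f` is a morphism of twisted Yetter–Drinfeld modules. -/
structure IsHom (X Y : TwistedYD Φ) (f : X →ₗ[k] Y) : Prop where
  comp : ∀ g x, f (X.comp g x) = Y.comp g (f x)
  act : ∀ g x, f (X.act g x) = Y.act g (f x)

variable {X Y Z W : TwistedYD Φ}

/-- Morphisms are the case of the identity of `G`, where the support condition is vacuous. The
naturality results thus apply to morphisms too. -/
theorem IsHom.isRes {f : X →ₗ[k] Y} (hf : IsHom X Y f) : IsRes (MonoidHom.id G) X Y f :=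
  ⟨hf.comp, fun g hg => absurd ⟨g, rfl⟩ hg, hf.act⟩

theorem IsHom.id (X : TwistedYD Φ) : IsHom X X LinearMap.id := ⟨fun _ _ => rfl, fun _ _ => rfl⟩

theorem IsHom.trans {f : X →ₗ[k] Y} {g : Y →ₗ[k] Z} (hg : IsHom Y Z g) (hf : IsHom X Y f) :
    IsHom X Z (g ∘ₗ f) :=
  ⟨fun a x => by simp [hf.comp, hg.comp], fun a x => by simp [hf.act, hg.act]⟩

theorem IsHom.add {f g : X →ₗ[k] Y} (hf : IsHom X Y f) (hg : IsHom X Y g) : IsHom X Y (f + g) :=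
  ⟨fun a x => by simp [hf.comp, hg.comp], fun a x => by simp [hf.act, hg.act]⟩

theorem IsHom.neg {f : X →ₗ[k] Y} (hf : IsHom X Y f) : IsHom X Y (-f) :=
  ⟨fun a x => by simp [hf.comp], fun a x => by simp [hf.act]⟩

theorem IsHom.symm {f : X ≃ₗ[k] Y} (hf : IsHom X Y f.toLinearMap) :
    IsHom Y X f.symm.toLinearMap :=
  ⟨fun a x => f.injective (by simpa using (hf.comp a (f.symm x)).symm),
    fun a x => f.injective (by simpa using (hf.act a (f.symm x)).symm)⟩

theorem IsHom.tensor {f : X →ₗ[k] Y} {g : Z →ₗ[k] W} (hf : IsHom X Y f) (hg : IsHom Z W g) :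
    IsHom (X.tensor Z) (Y.tensor W) (TensorProduct.map f g) :=
  have h := hf.isRes.tensor (IsPullback.id Φ) hg.isRes
  ⟨h.comp, h.act⟩

/-- For the coaction this is associativity of `G`; for the action it is the `2`-cocycle identity of
`Φ̃_g`. -/
theorem isHom_assocInv (X Y Z : TwistedYD Φ) :
    IsHom (X.tensor (Y.tensor Z)) ((X.tensor Y).tensor Z) (assocInv X Y Z) where
  comp g := by
    classical
    refine LinearMap.congr_fun (f := assocInv X Y Z ∘ₗ X.tensorComp (Y.tensor Z) g)
      (g := (X.tensor Y).tensorComp Z g ∘ₗ assocInv X Y Z) ?_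
    refine hom_ext_homog₃ X Y Z fun a b c x y z => ?_
    -- The inner tensor products are presented as homogeneous components, so that the formula for
    -- the outer tensor product applies to them.
    have e1 : (Y.tensor Z).comp (b * c) (Y.comp b y ⊗ₜ Z.comp c z) = Y.comp b y ⊗ₜ Z.comp c z := by
      simp [tensorComp_apply]
    have e2 : (X.tensor Y).comp (a * b) (X.comp a x ⊗ₜ Y.comp b y) = X.comp a x ⊗ₜ Y.comp b y := by
      simp [tensorComp_apply]
    have h1 := tensorComp_apply X (Y.tensor Z) g a (b * c) x (Y.comp b y ⊗ₜ Z.comp c z)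
    have h2 := tensorComp_apply (X.tensor Y) Z g (a * b) c (X.comp a x ⊗ₜ Y.comp b y) z
    rw [e1] at h1
    rw [e2] at h2
    rw [LinearMap.comp_apply, LinearMap.comp_apply, h1, assocInv_apply, map_smul, h2, mul_assoc]
    split_ifs <;> simp [assocInv_apply]
  act g := by
    refine LinearMap.congr_fun (f := assocInv X Y Z ∘ₗ X.tensorAct (Y.tensor Z) g)
      (g := (X.tensor Y).tensorAct Z g ∘ₗ assocInv X Y Z) ?_
    classical
    refine hom_ext_homog₃ X Y Z fun a b c x y z => ?_
    have e1 : ∀ y z, (Y.tensor Z).comp (b * c) (Y.comp b y ⊗ₜ Z.comp c z) =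
      Y.comp b y ⊗ₜ Z.comp c z := fun y z => by simp [tensorComp_apply]
    have e2 : ∀ x y, (X.tensor Y).comp (a * b) (X.comp a x ⊗ₜ Y.comp b y) =
      X.comp a x ⊗ₜ Y.comp b y := fun x y => by simp [tensorComp_apply]
    have h1 := tensorAct_apply X (Y.tensor Z) g a (b * c) x (Y.comp b y ⊗ₜ Z.comp c z)
    have h2 := tensorAct_apply (X.tensor Y) Z g (a * b) c (X.comp a x ⊗ₜ Y.comp b y) z
    change _ = _ • (_ ⊗ₜ (Y.tensor Z).comp (b * c) (Y.tensorAct Z g _)) at h1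
    change _ = _ • ((X.tensor Y).comp (a * b) (X.tensorAct Y g _) ⊗ₜ _) at h2
    rw [e1, tensorAct_apply, map_smul, e1] at h1
    rw [e2, tensorAct_apply, map_smul, e2] at h2
    rw [LinearMap.comp_apply, LinearMap.comp_apply, h1, assocInv_apply, map_smul, map_smul, h2,
      TensorProduct.tmul_smul, map_smul, assocInv_apply, ← TensorProduct.smul_tmul',
      smul_smul, smul_smul, smul_smul, smul_smul]
    congr 1
    have := congrArg Units.val (Φ.tilde_cocycle g a b c)
    simp only [Units.val_mul] at this
    linear_combination (Φ a b c : k) * this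

theorem assocHom_assocInv (X Y Z : TwistedYD Φ) :
    assocHom X Y Z ∘ₗ assocInv X Y Z = LinearMap.id := by
  refine hom_ext_homog₃ X Y Z fun a b c x y z => ?_
  simp [assocInv_apply, assocHom_apply, smul_smul]

theorem assocInv_assocHom (X Y Z : TwistedYD Φ) :
    assocInv X Y Z ∘ₗ assocHom X Y Z = LinearMap.id := by
  refine hom_ext_homog₃' X Y Z fun a b c x y z => ?_
  simp [assocInv_apply, assocHom_apply, smul_smul]

theorem isHom_assocHom (X Y Z : TwistedYD Φ) :
    IsHom ((X.tensor Y).tensor Z) (X.tensor (Y.tensor Z)) (assocHom X Y Z) :=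
  IsHom.symm (X := X.tensor (Y.tensor Z)) (Y := (X.tensor Y).tensor Z)
    (f := LinearEquiv.ofLinearMap (assocInv X Y Z) (assocHom X Y Z)
      (assocInv_assocHom X Y Z) (assocHom_assocInv X Y Z)) (isHom_assocInv X Y Z)

/-- The coaction part uses commutativity of `G`, the action part `tilde_braiding`. -/
theorem isHom_braiding (X Y : TwistedYD Φ) :
    IsHom (X.tensor Y) (Y.tensor X) (braiding X Y) where
  comp g := by
    classical
    refine LinearMap.congr_fun (f := braiding X Y ∘ₗ X.tensorComp Y g)
      (g := Y.tensorComp X g ∘ₗ braiding X Y) ?_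
    refine hom_ext_homog X Y fun a b x y => ?_
    simp only [LinearMap.comp_apply, tensorComp_apply, braiding_apply, ← Y.comp_act, mul_comm b a]
    split_ifs <;> simp [braiding_apply, Y.comp_act]
  act g := by
    refine LinearMap.congr_fun (f := braiding X Y ∘ₗ X.tensorAct Y g)
      (g := Y.tensorAct X g ∘ₗ braiding X Y) ?_
    refine hom_ext_homog X Y fun a b x y => ?_
    simp only [LinearMap.comp_apply, tensorAct_apply, braiding_apply, map_smul]
    rw [← Y.comp_act a b y, tensorAct_apply]
    simp only [Y.comp_act, Y.act_act, ← TensorProduct.smul_tmul', smul_smul, mul_comm g a]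
    congr 1
    have := congrArg Units.val (Φ.tilde_braiding g a b)
    simp only [Units.val_mul] at this
    exact this

theorem isHom_interchange (A B C D : TwistedYD Φ) :
    IsHom ((A.tensor B).tensor (C.tensor D)) ((A.tensor C).tensor (B.tensor D))
      (interchange A B C D) := by
  have h1 := isHom_assocHom A B (C.tensor D)
  have h2 := (IsHom.id A).tensor (isHom_assocInv B C D)
  have h3 := (IsHom.id A).tensor ((isHom_braiding B C).tensor (IsHom.id D))
  have h4 := (IsHom.id A).tensor (isHom_assocHom C B D)
  have h5 := isHom_assocInv A C (B.tensor D)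
  exact h5.trans (h4.trans (h3.trans (h2.trans h1)))

theorem isHom_rid (X : TwistedYD Φ) :
    IsHom (X.tensor (unit Φ)) X (TensorProduct.rid k X).toLinearMap where
  comp g := by
    classical
    refine LinearMap.congr_fun (f := (TensorProduct.rid k X).toLinearMap ∘ₗ X.tensorComp (unit Φ) g)
      (g := X.comp g ∘ₗ (TensorProduct.rid k X).toLinearMap) ?_
    refine hom_ext_homog X (unit Φ) fun a b x y => ?_
    rw [LinearMap.comp_apply, tensorComp_apply]
    by_cases hb : b = 1
    · subst hb
      simp only [mul_one, if_true, LinearMap.id_apply, LinearMap.comp_apply, LinearEquiv.coe_coe,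
        TensorProduct.rid_tmul, map_smul, comp_apply_comp, eq_comm (a := g)]
      split_ifs <;> simp
    · simp [hb]
  act g := by
    refine LinearMap.congr_fun (f := (TensorProduct.rid k X).toLinearMap ∘ₗ X.tensorAct (unit Φ) g)
      (g := X.act g ∘ₗ (TensorProduct.rid k X).toLinearMap) ?_
    refine hom_ext_homog X (unit Φ) fun a b x y => ?_
    rw [LinearMap.comp_apply, tensorAct_apply]
    by_cases hb : b = 1
    · subst hb
      simp [Φ.tilde_one_right, X.comp_act]
    · simp [hb]

theorem isHom_lid (X : TwistedYD Φ) :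
    IsHom ((unit Φ).tensor X) X (TensorProduct.lid k X).toLinearMap where
  comp g := by
    classical
    refine LinearMap.congr_fun (f := (TensorProduct.lid k X).toLinearMap ∘ₗ (unit Φ).tensorComp X g)
      (g := X.comp g ∘ₗ (TensorProduct.lid k X).toLinearMap) ?_
    refine hom_ext_homog (unit Φ) X fun b a y x => ?_
    rw [LinearMap.comp_apply, tensorComp_apply]
    by_cases hb : b = 1
    · subst hb
      simp only [one_mul, if_true, LinearMap.id_apply, LinearMap.comp_apply, LinearEquiv.coe_coe,
        TensorProduct.lid_tmul, map_smul, comp_apply_comp, eq_comm (a := g)]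
      split_ifs <;> simp
    · simp [hb]
  act g := by
    refine LinearMap.congr_fun (f := (TensorProduct.lid k X).toLinearMap ∘ₗ (unit Φ).tensorAct X g)
      (g := X.act g ∘ₗ (TensorProduct.lid k X).toLinearMap) ?_
    refine hom_ext_homog (unit Φ) X fun b a y x => ?_
    rw [LinearMap.comp_apply, tensorAct_apply]
    by_cases hb : b = 1
    · subst hb
      simp [Φ.tilde_one_mid, X.comp_act]
    · simp [hb]

/-! ### The structure maps of the tensor algebra are morphisms -/

variable {X Y : TwistedYD Φ}

theorem isHom_incl (X : TwistedYD Φ) (n : ℕ) : IsHom (X.tpow n) X.T (X.incl n) :=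
  ⟨fun g x => (DirectSum.lmap_lof (fun n => (X.tpow n).comp g) n x).symm,
    fun g x => (DirectSum.lmap_lof (fun n => (X.tpow n).act g) n x).symm⟩

theorem isHom_of_incl {f : X.T →ₗ[k] Y} (h : ∀ n, IsHom (X.tpow n) Y (f ∘ₗ X.incl n)) :
    IsHom X.T Y f where
  comp g := by
    refine LinearMap.congr_fun (f := f ∘ₗ X.T.comp g) (g := Y.comp g ∘ₗ f) ?_
    refine X.T_hom_ext fun n => LinearMap.ext fun x => ?_
    exact (congrArg f ((X.isHom_incl n).comp g x).symm).trans ((h n).comp g x)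
  act g := by
    refine LinearMap.congr_fun (f := f ∘ₗ X.T.act g) (g := Y.act g ∘ₗ f) ?_
    refine X.T_hom_ext fun n => LinearMap.ext fun x => ?_
    exact (congrArg f ((X.isHom_incl n).act g x).symm).trans ((h n).act g x)

theorem isHom_of_incl₂ {f : X.T ⊗[k] X.T →ₗ[k] Y}
    (h : ∀ n m, IsHom ((X.tpow n).tensor (X.tpow m)) Y
      (f ∘ₗ TensorProduct.map (X.incl n) (X.incl m))) :
    IsHom (X.T.tensor X.T) Y f where
  comp g := by
    refine LinearMap.congr_fun (f := f ∘ₗ (X.T.tensor X.T).comp g) (g := Y.comp g ∘ₗ f) ?_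
    refine X.TT_hom_ext fun n m => LinearMap.ext fun x => ?_
    exact (congrArg f (((X.isHom_incl n).tensor (X.isHom_incl m)).comp g x).symm).trans
      ((h n m).comp g x)
  act g := by
    refine LinearMap.congr_fun (f := f ∘ₗ (X.T.tensor X.T).act g) (g := Y.act g ∘ₗ f) ?_
    refine X.TT_hom_ext fun n m => LinearMap.ext fun x => ?_
    exact (congrArg f (((X.isHom_incl n).tensor (X.isHom_incl m)).act g x).symm).trans
      ((h n m).act g x)

theorem isHom_mulPow (X : TwistedYD Φ) (n m : ℕ) :
    IsHom ((X.tpow n).tensor (X.tpow m)) (X.tpow (n + m)) (X.mulPow n m) := by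
  induction m with
  | zero => exact isHom_rid (X.tpow n)
  | succ m ih => exact (ih.tensor (IsHom.id X)).trans (isHom_assocInv (X.tpow n) (X.tpow m) X)

/-- Hence each `e` in `G` acts on homogeneous products multiplicatively up to a nonzero scalar,
which is what moves ideals to ideals below. -/
theorem isHom_mul (X : TwistedYD Φ) : IsHom (X.T.tensor X.T) X.T X.mul := by
  refine isHom_of_incl₂ fun n m => ?_
  rw [mul_incl]
  exact (X.isHom_incl _).trans (X.isHom_mulPow n m)

theorem isHom_mul₂ (X : TwistedYD Φ) :
    IsHom ((X.T.tensor X.T).tensor (X.T.tensor X.T)) (X.T.tensor X.T) X.mul₂ :=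
  (X.isHom_mul.tensor X.isHom_mul).trans (isHom_interchange X.T X.T X.T X.T)

theorem isHom_ι (X : TwistedYD Φ) : IsHom X X.T X.ι :=
  (X.isHom_incl 1).trans (isHom_lid X).symm

theorem isHom_unitMap (X : TwistedYD Φ) : IsHom (unit Φ) X.T X.unitMap :=
  X.isHom_incl 0

theorem isHom_primitive (X : TwistedYD Φ) : IsHom X (X.T.tensor X.T) X.primitive := by
  rw [primitive_eq]
  exact ((X.isHom_ι.tensor X.isHom_unitMap).trans (isHom_rid X).symm).add
    ((X.isHom_unitMap.tensor X.isHom_ι).trans (isHom_lid X).symm)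

theorem isHom_comulPow (X : TwistedYD Φ) (n : ℕ) :
    IsHom (X.tpow n) (X.T.tensor X.T) (X.comulPow n) := by
  induction n with
  | zero =>
    rw [comulPow_zero]
    exact (X.isHom_unitMap.tensor X.isHom_unitMap).trans (isHom_lid (unit Φ)).symm
  | succ n ih => exact X.isHom_mul₂.trans (ih.tensor X.isHom_primitive)

theorem isHom_comul (X : TwistedYD Φ) : IsHom X.T (X.T.tensor X.T) X.comul :=
  isHom_of_incl fun n => by rw [comul_incl]; exact X.isHom_comulPow n

theorem isHom_antipodePow (X : TwistedYD Φ) (n : ℕ) :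
    IsHom (X.tpow n) X.T (X.antipodePow n) := by
  induction n with
  | zero => exact X.isHom_incl 0
  | succ n ih =>
    exact X.isHom_mul.trans ((isHom_braiding X.T X.T).trans (ih.tensor X.isHom_ι.neg))

theorem isHom_antipode (X : TwistedYD Φ) : IsHom X.T X.T X.antipode :=
  isHom_of_incl fun n => by rw [antipode_incl]; exact X.isHom_antipodePow n

/-! ### Ideals of the tensor algebra -/

theorem tmul_mem_coidealSpan_left {X : TwistedYD Φ} {I : Submodule k X.T} {x : X.T} (hx : x ∈ I)
    (y : X.T) : x ⊗ₜ y ∈ X.coidealSpan I :=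
  Submodule.mem_sup_left ⟨(⟨x, hx⟩ : I) ⊗ₜ y, rfl⟩

theorem tmul_mem_coidealSpan_right {X : TwistedYD Φ} {I : Submodule k X.T} {x : X.T} (hx : x ∈ I)
    (y : X.T) : y ⊗ₜ x ∈ X.coidealSpan I :=
  Submodule.mem_sup_right ⟨y ⊗ₜ (⟨x, hx⟩ : I), rfl⟩

theorem coidealSpan_le {X : TwistedYD Φ} {I : Submodule k X.T} {P : Submodule k (X.T ⊗[k] X.T)}
    (hl : ∀ x ∈ I, ∀ y, x ⊗ₜ y ∈ P) (hr : ∀ x ∈ I, ∀ y, y ⊗ₜ x ∈ P) : X.coidealSpan I ≤ P := by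
  refine sup_le ?_ ?_
  · rintro _ ⟨z, rfl⟩
    induction z with
    | zero => simp
    | tmul x y => exact hl x x.2 y
    | add a b ha hb => rw [map_add]; exact add_mem ha hb
  · rintro _ ⟨z, rfl⟩
    induction z with
    | zero => simp
    | tmul x y => exact hr y y.2 x
    | add a b ha hb => rw [map_add]; exact add_mem ha hb

/-- On the component of degree `g` the operator of `e⁻¹` inverts that of `e` up to the scalar
`Φ̃_g(e, e⁻¹)`. -/
theorem act_surjective (X : TwistedYD Φ) (e g : G) (x : X) :
    ∃ y, X.act e (X.comp g y) = X.comp g x := by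
  refine ⟨(((Φ.tilde g e e⁻¹)⁻¹ : kˣ) : k) • X.act e⁻¹ (X.comp g x), ?_⟩
  rw [map_smul, map_smul, X.comp_act, X.comp_self, X.act_act, mul_inv_cancel, X.act_one, smul_smul]
  simp

/-- The conditions on a graded Hopf ideal, without stability under the action. -/
structure IsColinearHopfIdeal (X : TwistedYD Φ) (I : Submodule k X.T) : Prop where
  comp : ∀ g, ∀ x ∈ I, X.T.comp g x ∈ I
  graded : ∀ x ∈ I, ∀ n, X.incl n (x n) ∈ I
  degree_zero : ∀ x ∈ I, x 0 = 0
  degree_one : ∀ x ∈ I, x 1 = 0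
  mul_right : ∀ x ∈ I, ∀ y, X.mul (x ⊗ₜ y) ∈ I
  mul_left : ∀ x ∈ I, ∀ y, X.mul (y ⊗ₜ x) ∈ I
  comul : ∀ x ∈ I, X.comul x ∈ X.coidealSpan I
  antipode : ∀ x ∈ I, X.antipode x ∈ I

/-- The span of the translates of `I`. -/
def translates (X : TwistedYD Φ) (I : Submodule k X.T) : Submodule k X.T :=
  ⨆ e, I.map (X.T.act e)

theorem translates_le {X : TwistedYD Φ} {I P : Submodule k X.T}
    (h : ∀ e, ∀ x ∈ I, X.T.act e x ∈ P) : X.translates I ≤ P :=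
  iSup_le fun e => by
    rintro _ ⟨x, hx, rfl⟩
    exact h e x hx

theorem act_mem_translates {X : TwistedYD Φ} {I : Submodule k X.T} (e : G) {x : X.T}
    (hx : x ∈ I) : X.T.act e x ∈ X.translates I :=
  Submodule.mem_iSup_of_mem e ⟨x, hx, rfl⟩

theorem translates_induction {X : TwistedYD Φ} {I : Submodule k X.T} {M : Type*} [AddCommGroup M]
    [Module k M] (p : X.T →ₗ[k] M) (P : Submodule k M)
    (h : ∀ e, ∀ x ∈ I, p (X.T.act e x) ∈ P) : ∀ x ∈ X.translates I, p x ∈ P :=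
  translates_le (P := P.comap p) h

/-- Since the structure maps are morphisms, each closure property of `I` passes to its translates.
The scalars depend on degrees, so elements are first split into homogeneous components, which stay
in `I` by `h.comp`. -/
theorem IsColinearHopfIdeal.translates {X : TwistedYD Φ} {I : Submodule k X.T}
    (h : X.IsColinearHopfIdeal I) : X.IsGradedHopfIdeal (X.translates I) := by
  have homog : ∀ (e f : G), ∀ x ∈ I, X.T.act f (X.T.act e x) ∈ X.translates I := fun e f x hx => by
    rw [← X.T.sum_comp x, map_sum, map_sum]
    refine sum_mem fun g _ => ?_
    rw [X.T.act_act]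
    exact Submodule.smul_mem _ _ (act_mem_translates _ (h.comp g x hx))
  -- Any homogeneous `y` has the form `e ▷ b`, so `(e ▷ x) y` is a multiple of `e ▷ (x b)`; likewise
  -- on the other side.
  have hmul : ∀ e g f (a b : X.T), X.mul (X.T.act e (X.T.comp g a) ⊗ₜ X.T.act e (X.T.comp f b)) =
      (((Φ.tilde e g f)⁻¹ : kˣ) : k) • X.T.act e (X.mul (X.T.comp g a ⊗ₜ X.T.comp f b)) := by
    intro e g f a b
    rw [← X.isHom_mul.act]
    change _ = _ • X.mul (X.T.tensorAct X.T e _)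
    rw [tensorAct_apply, map_smul, smul_smul, X.T.comp_act, X.T.comp_act]
    simp
  constructor
  · refine ⟨fun g => translates_induction _ _ fun e x hx => ?_,
      fun f => translates_induction _ _ fun e x hx => homog e f x hx⟩
    rw [X.T.comp_act]
    exact act_mem_translates e (h.comp g x hx)
  · intro x hx n
    refine translates_induction (X.incl n ∘ₗ DirectSum.component k ℕ (fun n => X.tpow n) n) _
      (fun e x hx => ?_) x hx
    have : X.incl n (X.T.act e x n) = X.T.act e (X.incl n (x n)) := (X.isHom_incl n).act e (x n)
    change X.incl n (X.T.act e x n) ∈ _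
    rw [this]
    exact act_mem_translates e (h.graded x hx n)
  · refine translates_induction (DirectSum.component k ℕ (fun n => X.tpow n) 0) ⊥ fun e x hx => ?_
    change (X.tpow 0).act e (x 0) = 0
    rw [h.degree_zero x hx, map_zero]
  · refine translates_induction (DirectSum.component k ℕ (fun n => X.tpow n) 1) ⊥ fun e x hx => ?_
    change (X.tpow 1).act e (x 1) = 0
    rw [h.degree_one x hx, map_zero]
  · intro x hx y
    refine translates_induction (X.mul ∘ₗ (TensorProduct.mk k X.T X.T).flip y) _
      (fun e x hx => ?_) x hx
    change X.mul (X.T.act e x ⊗ₜ y) ∈ _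
    rw [← X.T.sum_comp x, ← X.T.sum_comp y]
    simp only [map_sum, TensorProduct.sum_tmul, TensorProduct.tmul_sum]
    refine sum_mem fun g _ => sum_mem fun f _ => ?_
    obtain ⟨b, hb⟩ := X.T.act_surjective e g y
    rw [← hb, hmul]
    exact Submodule.smul_mem _ _ (act_mem_translates e (h.mul_right _ (h.comp _ x hx) _))
  · intro x hx y
    refine translates_induction (X.mul ∘ₗ TensorProduct.mk k X.T X.T y) _
      (fun e x hx => ?_) x hx
    change X.mul (y ⊗ₜ X.T.act e x) ∈ _
    rw [← X.T.sum_comp x, ← X.T.sum_comp y]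
    simp only [map_sum, TensorProduct.sum_tmul, TensorProduct.tmul_sum]
    refine sum_mem fun g _ => sum_mem fun f _ => ?_
    obtain ⟨b, hb⟩ := X.T.act_surjective e f y
    rw [← hb, hmul]
    exact Submodule.smul_mem _ _ (act_mem_translates e (h.mul_left _ (h.comp _ x hx) _))
  · refine translates_induction _ _ fun e x hx => ?_
    rw [X.isHom_comul.act]
    refine coidealSpan_le (P := (X.coidealSpan (X.translates I)).comap (X.T.tensorAct X.T e))
      (fun a ha b => ?_) (fun a ha b => ?_) (h.comul x hx)
    all_goals
      rw [Submodule.mem_comap, ← X.T.sum_comp a, ← X.T.sum_comp b]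
      simp only [map_sum, TensorProduct.sum_tmul, TensorProduct.tmul_sum]
      refine sum_mem fun g _ => sum_mem fun f _ => ?_
      rw [tensorAct_apply, X.T.comp_act, X.T.comp_act]
      refine Submodule.smul_mem _ _ ?_
    · exact tmul_mem_coidealSpan_left (act_mem_translates e (h.comp _ a ha)) _
    · exact tmul_mem_coidealSpan_right (act_mem_translates e (h.comp _ a ha)) _
  · refine translates_induction X.counit ⊥ fun e x hx => ?_
    change (X.tpow 0).act e (x 0) = 0
    rw [h.degree_zero x hx, map_zero]
  · refine translates_induction _ _ fun e x hx => ?_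
    rw [X.isHom_antipode.act]
    exact act_mem_translates e (h.antipode x hx)

/-- The translate by `1` is `I` itself. So the Nichols ideal remains the largest one when stability
under the action is not demanded. -/
theorem IsColinearHopfIdeal.le_nicholsIdeal {X : TwistedYD Φ} {I : Submodule k X.T}
    (h : X.IsColinearHopfIdeal I) : I ≤ X.nicholsIdeal := fun x hx => by
  refine X.le_nicholsIdeal h.translates ?_
  rw [← X.T.act_one x]
  exact act_mem_translates 1 hx

/-! ### Nichols ideals under a change of group -/

section Functor

variable {H : Type*} [CommGroup H] [Finite H] {Ψ : Cocycle3 k H}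
  {j : H →* G} {X : TwistedYD Φ} {Y : TwistedYD Ψ}

theorem map_mem_coidealSpan (p : X.T →ₗ[k] Y.T) {I : Submodule k X.T} {J : Submodule k Y.T}
    (h : ∀ x ∈ I, p x ∈ J) {z : X.T ⊗[k] X.T} (hz : z ∈ X.coidealSpan I) :
    TensorProduct.map p p z ∈ Y.coidealSpan J :=
  coidealSpan_le (P := (Y.coidealSpan J).comap (TensorProduct.map p p))
    (fun _ hx _ => tmul_mem_coidealSpan_left (h _ hx) _)
    (fun _ hx _ => tmul_mem_coidealSpan_right (h _ hx) _) hz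

variable {f : X ≃ₗ[k] Y}

/-- The image of the Nichols ideal is a graded Hopf ideal. -/
theorem isGradedHopfIdeal_map (hj : IsPullback j Φ Ψ) (hf : IsRes j X Y f.toLinearMap) :
    Y.IsGradedHopfIdeal (X.nicholsIdeal.map (TMap f.toLinearMap)) := by
  have hI := X.nicholsIdeal_isGradedHopfIdeal
  have hT := hf.TMap hj
  have hm := fun z => LinearMap.congr_fun (mul_naturality hj hf) z
  have hc := fun z => LinearMap.congr_fun (comul_naturality hj hf) z
  have ha := fun z => LinearMap.congr_fun (antipode_naturality hj hf) z
  simp only [LinearMap.comp_apply] at hm hc ha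
  constructor
  · refine ⟨?_, ?_⟩
    · rintro g _ ⟨x, hx, rfl⟩
      exact ⟨_, hI.isSub.1 (j g) x hx, hT.comp g x⟩
    · rintro g _ ⟨x, hx, rfl⟩
      exact ⟨_, hI.isSub.2 (j g) x hx, hT.act g x⟩
  · rintro _ ⟨x, hx, rfl⟩ n
    refine ⟨_, hI.graded x hx n, ?_⟩
    rw [TMap_apply]
    exact LinearMap.congr_fun (TMap_incl f.toLinearMap n) (x n)
  · rintro _ ⟨x, hx, rfl⟩
    rw [TMap_apply, hI.degree_zero x hx, map_zero]
  · rintro _ ⟨x, hx, rfl⟩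
    rw [TMap_apply, hI.degree_one x hx, map_zero]
  · rintro _ ⟨x, hx, rfl⟩ y
    obtain ⟨y, rfl⟩ := (TEquiv f).surjective y
    exact ⟨_, hI.mul_right x hx y, (hm (x ⊗ₜ y)).symm⟩
  · rintro _ ⟨x, hx, rfl⟩ y
    obtain ⟨y, rfl⟩ := (TEquiv f).surjective y
    exact ⟨_, hI.mul_left x hx y, (hm (y ⊗ₜ x)).symm⟩
  · rintro _ ⟨x, hx, rfl⟩
    rw [hc]
    exact map_mem_coidealSpan _ (fun x hx => Submodule.mem_map_of_mem hx) (hI.comul x hx)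
  · rintro _ ⟨x, hx, rfl⟩
    change TMap f.toLinearMap x 0 = 0
    rw [TMap_apply, hI.degree_zero x hx, map_zero]
  · rintro _ ⟨x, hx, rfl⟩
    exact ⟨_, hI.antipode x hx, (ha x).symm⟩

/-- The preimage of the Nichols ideal satisfies all conditions on a graded Hopf ideal, except for
stability under the action. -/
theorem isColinearHopfIdeal_comap (hj : IsPullback j Φ Ψ) (hf : IsRes j X Y f.toLinearMap) :
    X.IsColinearHopfIdeal (Y.nicholsIdeal.comap (TMap f.toLinearMap)) := by
  have hI := Y.nicholsIdeal_isGradedHopfIdeal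
  have hT := hf.TMap hj
  have hm := fun z => LinearMap.congr_fun (mul_naturality hj hf) z
  have hc := fun z => LinearMap.congr_fun (comul_naturality hj hf) z
  have ha := fun z => LinearMap.congr_fun (antipode_naturality hj hf) z
  simp only [LinearMap.comp_apply] at hm hc ha
  have hd : ∀ x, TMap f.toLinearMap x ∈ Y.nicholsIdeal → ∀ n, TMap f.toLinearMap x n = 0 →
      x n = 0 := fun x _ n h => by
    have := congrArg (tpowMap f.symm.toLinearMap n) h
    rw [TMap_apply, map_zero, ← LinearMap.comp_apply, ← tpowMap_comp, f.symm_comp, tpowMap_id] at this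
    exact this
  constructor
  · intro g x hx
    rw [Submodule.mem_comap] at hx ⊢
    rcases hT.cases g with hg | ⟨g, rfl⟩
    · rw [hg]
      exact zero_mem _
    · rw [hT.comp]
      exact hI.isSub.1 g _ hx
  · intro x hx n
    have := hI.graded _ hx n
    rw [TMap_apply] at this
    rw [Submodule.mem_comap, ← LinearMap.comp_apply, TMap_incl]
    exact this
  · exact fun x hx => hd x hx 0 (hI.degree_zero _ hx)
  · exact fun x hx => hd x hx 1 (hI.degree_one _ hx)
  · intro x hx y
    rw [Submodule.mem_comap, ← hm]
    exact hI.mul_right _ hx _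
  · intro x hx y
    rw [Submodule.mem_comap, ← hm]
    exact hI.mul_left _ hx _
  · intro x hx
    have h1 := hI.comul _ hx
    rw [hc] at h1
    -- Carrying `I ⊗ T + T ⊗ I` back needs only a linear map, so no compatibility of `f.symm` with
    -- the actions is required.
    have h2 := map_mem_coidealSpan (TMap f.symm.toLinearMap)
      (J := Y.nicholsIdeal.comap (TMap f.toLinearMap)) (fun y hy => ?_) h1
    · rw [← LinearMap.comp_apply, ← TensorProduct.map_comp, ← TMap_comp, f.symm_comp, TMap_id,
        TensorProduct.map_id] at h2
      exact h2
    · rw [Submodule.mem_comap, ← LinearMap.comp_apply, ← TMap_comp, f.comp_symm, TMap_id]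
      exact hy
  · intro x hx
    rw [Submodule.mem_comap, ← ha]
    exact hI.antipode _ hx

/-- The isomorphism of tensor algebras maps the Nichols ideal onto the Nichols ideal. -/
theorem nicholsIdeal_map (hj : IsPullback j Φ Ψ) (hf : IsRes j X Y f.toLinearMap) :
    X.nicholsIdeal.map (TEquiv f).toLinearMap = Y.nicholsIdeal := by
  refine le_antisymm (Y.le_nicholsIdeal (isGradedHopfIdeal_map hj hf)) fun y hy => ?_
  obtain ⟨x, rfl⟩ := (TEquiv f).surjective y
  -- The preimage need not be visibly stable under all of `G`; passing to translates makes this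
  -- harmless.
  exact ⟨x, (isColinearHopfIdeal_comap hj hf).le_nicholsIdeal hy, rfl⟩

/-- The isomorphism of Nichols algebras induced by a linear isomorphism of the modules which is
compatible with the change of the group. -/
def nicholsEquiv (hj : IsPullback j Φ Ψ) (hf : IsRes j X Y f.toLinearMap) :
    X.Nichols ≃ₗ[k] Y.Nichols :=
  Submodule.Quotient.equiv _ _ (TEquiv f) (nicholsIdeal_map hj hf)

theorem nicholsEquiv_mkQ (hj : IsPullback j Φ Ψ) (hf : IsRes j X Y f.toLinearMap) (x : X.T) :
    nicholsEquiv hj hf (X.nicholsIdeal.mkQ x) = Y.nicholsIdeal.mkQ (TMap f.toLinearMap x) := rfl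

theorem nicholsEquiv_mul (hj : IsPullback j Φ Ψ) (hf : IsRes j X Y f.toLinearMap)
    (x y : X.Nichols) : nicholsEquiv hj hf (X.nicholsMul x y) =
      Y.nicholsMul (nicholsEquiv hj hf x) (nicholsEquiv hj hf y) := by
  obtain ⟨x, rfl⟩ := X.nicholsIdeal.mkQ_surjective x
  obtain ⟨y, rfl⟩ := X.nicholsIdeal.mkQ_surjective y
  rw [nicholsMul_mkQ, nicholsEquiv_mkQ, nicholsEquiv_mkQ, nicholsEquiv_mkQ, nicholsMul_mkQ]
  exact congrArg _ (LinearMap.congr_fun (mul_naturality hj hf) (x ⊗ₜ y)).symm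

theorem nicholsEquiv_comul (hj : IsPullback j Φ Ψ) (hf : IsRes j X Y f.toLinearMap)
    (x : X.Nichols) : Y.nicholsComul (nicholsEquiv hj hf x) =
      TensorProduct.map (nicholsEquiv hj hf).toLinearMap (nicholsEquiv hj hf).toLinearMap
        (X.nicholsComul x) := by
  obtain ⟨x, rfl⟩ := X.nicholsIdeal.mkQ_surjective x
  rw [nicholsComul_mkQ, nicholsEquiv_mkQ, nicholsComul_mkQ]
  have h := LinearMap.congr_fun (comul_naturality hj hf) x
  simp only [LinearMap.comp_apply] at h
  rw [h, ← LinearMap.comp_apply, ← TensorProduct.map_comp,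
    ← LinearMap.comp_apply (TensorProduct.map (nicholsEquiv hj hf).toLinearMap _),
    ← TensorProduct.map_comp]
  rfl

end Functor

/-! ### The multigrading -/

theorem iSup_multiPow (X : TwistedYD Φ) {l : ℕ} {L : Fin l → Submodule k X} (hL : iSup L = ⊤)
    (n : ℕ) : ⨆ d, X.multiPow L n d = ⊤ := by
  induction n with
  | zero =>
    refine eq_top_iff.2 (le_trans ?_ (le_iSup _ 0))
    simp [multiPow]
  | succ n ih =>
    have h : (⊤ : Submodule k (X.tpow n ⊗[k] X)) = ⨆ d, ⨆ i, Submodule.map₂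
        (TensorProduct.mk k (X.tpow n) X) (X.multiPow L n d) (L i) := by
      rw [← TensorProduct.map₂_mk_top_top_eq_top, ← ih, ← hL, Submodule.map₂_iSup_left]
      simp only [Submodule.map₂_iSup_right]
    refine eq_top_iff.2 (h.le.trans (iSup_le fun d => iSup_le fun i => ?_))
    -- A further factor from `L i` raises the degree `d` by `e_i`.
    refine le_trans ?_ (le_iSup _ (d + Pi.single i 1))
    refine le_trans ?_ (le_iSup _ i)
    rw [add_sub_cancel_right]
    exact le_rfl

theorem iSup_nicholsDegree (X : TwistedYD Φ) {l : ℕ} {L : Fin l → Submodule k X}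
    (hL : iSup L = ⊤) : ⨆ d, X.nicholsDegree L d = ⊤ := by
  simp only [nicholsDegree, ← Submodule.map_iSup]
  rw [iSup_comm]
  simp only [← Submodule.map_iSup, X.iSup_multiPow hL]
  have : ⨆ n, Submodule.map (X.incl n) ⊤ = ⊤ := by
    simp only [Submodule.map_top]
    exact DFinsupp.iSup_range_lsingle
  rw [this, Submodule.map_top, Submodule.range_mkQ]

section Functor

variable {H : Type*} [CommGroup H] [Finite H] {Ψ : Cocycle3 k H}
  {j : H →* G} {X : TwistedYD Φ} {Y : TwistedYD Ψ}

theorem multiPow_map (f : X →ₗ[k] Y) {l : ℕ} (L : Fin l → Submodule k X) (n : ℕ)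
    (d : Fin l → ℤ) : (X.multiPow L n d).map (tpowMap f n) =
      Y.multiPow (fun i => (L i).map f) n d := by
  induction n generalizing d with
  | zero => exact Submodule.map_id _
  | succ n ih =>
    change Submodule.map (TensorProduct.map (tpowMap f n) f) (⨆ i, Submodule.map₂
      (TensorProduct.mk k (X.tpow n) X) (X.multiPow L n (d - Pi.single i 1)) (L i)) =
        ⨆ i, Submodule.map₂ (TensorProduct.mk k (Y.tpow n) Y) _ ((L i).map f)
    rw [Submodule.map_iSup]
    refine iSup_congr fun i => ?_
    rw [← ih, Submodule.map_map₂, Submodule.map₂_map_map]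
    rfl

theorem nicholsDegree_map {f : X ≃ₗ[k] Y} (hj : IsPullback j Φ Ψ)
    (hf : IsRes j X Y f.toLinearMap) {l : ℕ} (L : Fin l → Submodule k X) (d : Fin l → ℤ) :
    (X.nicholsDegree L d).map (nicholsEquiv hj hf).toLinearMap =
      Y.nicholsDegree (fun i => (L i).map f.toLinearMap) d := by
  have h : (nicholsEquiv hj hf).toLinearMap ∘ₗ X.nicholsIdeal.mkQ =
    Y.nicholsIdeal.mkQ ∘ₗ TMap f.toLinearMap := rfl
  rw [nicholsDegree, nicholsDegree, ← Submodule.map_comp, h, Submodule.map_comp, Submodule.map_iSup]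
  congr 1
  refine iSup_congr fun n => ?_
  rw [← multiPow_map, ← Submodule.map_comp, TMap_incl, Submodule.map_comp]

end Functor

/-! ### Multidegrees as eigenspaces of a diagonal automorphism -/

theorem tpowMap_of_mem_multiPow {X : TwistedYD Φ} {f : X →ₗ[k] X} {l : ℕ}
    {L : Fin l → Submodule k X} {c : Fin l → k} (hc : ∀ i, c i ≠ 0)
    (hf : ∀ i, ∀ x ∈ L i, f x = c i • x) (n : ℕ) (d : Fin l → ℤ) :
    ∀ x ∈ X.multiPow L n d, tpowMap f n x = (∏ i, c i ^ d i) • x := by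
  induction n generalizing d with
  | zero =>
    intro x hx
    by_cases hd : d = 0
    · subst hd
      simp only [Pi.zero_apply, zpow_zero, Finset.prod_const_one, one_smul]
      rfl
    · simp only [multiPow, hd, iSup_false] at hx
      rw [(Submodule.mem_bot k).1 hx, map_zero, smul_zero]
  | succ n ih =>
    suffices X.multiPow L (n + 1) d ≤
        LinearMap.eqLocus (tpowMap f (n + 1)) ((∏ i, c i ^ d i) • LinearMap.id) from
      fun x hx => this hx
    refine iSup_le fun i => Submodule.map₂_le.2 fun y hy x hx => ?_
    change tpowMap f n y ⊗ₜ[k] f x = (∏ i, c i ^ d i) • (y ⊗ₜ[k] x)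
    rw [ih _ y hy, hf i x hx, TensorProduct.smul_tmul_smul]
    congr 1
    -- Only the `i`-th factor changes: the new tensor factor supplies the `c i` that lifts the
    -- exponent from `d i - 1` to `d i`.
    rw [← Finset.prod_erase_mul _ _ (Finset.mem_univ i),
      ← Finset.prod_erase_mul _ (fun i => c i ^ d i) (Finset.mem_univ i), mul_assoc]
    congr 1
    · refine Finset.prod_congr rfl fun m hm => ?_
      rw [Pi.sub_apply, Pi.single_eq_of_ne (Finset.ne_of_mem_erase hm), sub_zero]
    · rw [Pi.sub_apply, Pi.single_eq_same, zpow_sub_one₀ (hc i), inv_mul_cancel_right₀ (hc i)]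

theorem nicholsDegree_le_eigenspace {X : TwistedYD Φ} {f : X ≃ₗ[k] X}
    (hf : IsRes (MonoidHom.id G) X X f.toLinearMap) {l : ℕ}
    {L : Fin l → Submodule k X} {c : Fin l → k} (hc : ∀ i, c i ≠ 0)
    (hfc : ∀ i, ∀ x ∈ L i, f x = c i • x) (d : Fin l → ℤ) :
    X.nicholsDegree L d ≤ Module.End.eigenspace
      (nicholsEquiv (IsPullback.id Φ) hf).toLinearMap (∏ i, c i ^ d i) := by
  refine Submodule.map_le_iff_le_comap.2 (iSup_le fun n => Submodule.map_le_iff_le_comap.2 ?_)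
  intro x hx
  rw [Submodule.mem_comap, Submodule.mem_comap, Module.End.mem_eigenspace_iff]
  change X.nicholsIdeal.mkQ ((TMap f.toLinearMap ∘ₗ X.incl n) x) = _
  rw [TMap_incl, LinearMap.comp_apply, tpowMap_of_mem_multiPow hc hfc n d x hx, map_smul, map_smul]

/-- In characteristic zero the equation descends to `ℚ`, where the valuation at the `m`-th prime
recovers `d m`. -/
theorem prod_prime_zpow_injective (k : Type*) [Field k] [CharZero k] (l : ℕ) :
    Function.Injective fun d : Fin l → ℤ => ∏ i : Fin l, ((Nat.nth Nat.Prime i : ℕ) : k) ^ d i := by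
  have key : ∀ d : Fin l → ℤ, ∀ m : Fin l,
      padicValRat (Nat.nth Nat.Prime m) (∏ i : Fin l, ((Nat.nth Nat.Prime i : ℕ) : ℚ) ^ d i) = d m := by
    intro d m
    have hp : ∀ i, Fact (Nat.nth Nat.Prime i).Prime := fun i => ⟨Nat.prime_nth_prime i⟩
    have h0 : ∀ i, ((Nat.nth Nat.Prime i : ℕ) : ℚ) ≠ 0 := fun i =>
      Nat.cast_ne_zero.2 (hp i).out.ne_zero
    have h : ∀ s : Finset (Fin l), padicValRat (Nat.nth Nat.Prime m)
        (∏ i ∈ s, ((Nat.nth Nat.Prime i : ℕ) : ℚ) ^ d i) = ∑ i ∈ s, if i = m then d i else 0 := by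
      intro s
      induction s using Finset.induction_on with
      | empty => simp
      | insert i s his ih =>
        rw [Finset.prod_insert his, Finset.sum_insert his,
          padicValRat.mul (zpow_ne_zero _ (h0 i))
            (Finset.prod_ne_zero_iff.2 fun (i : Fin l) _ => zpow_ne_zero (d i) (h0 i)), ih, padicValRat.zpow,
          padicValRat.of_nat]
        congr 1
        split_ifs with him
        · subst him
          simp [padicValNat_self]
        · have hne : Nat.nth Nat.Prime m ≠ Nat.nth Nat.Prime i := fun h => him
            (Fin.ext (Nat.nth_injective Nat.infinite_setOfPred_prime h)).symm
          rw [padicValNat_primes hne]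
          simp
    rw [h]
    simp
  intro d e hde
  have hq : (∏ i : Fin l, ((Nat.nth Nat.Prime i : ℕ) : ℚ) ^ d i) =
      ∏ i : Fin l, ((Nat.nth Nat.Prime i : ℕ) : ℚ) ^ e i := by
    apply Rat.cast_injective (α := k)
    push_cast
    exact hde
  funext m
  rw [← key d m, hq, key e m]

/-- Scaling the basis vectors commutes with action and coaction because these are diagonal in the
basis. It therefore induces an automorphism of `B(X)`, and with primes as scalars this one
automorphism separates all multidegrees. -/
theorem isNicholsGraded_of_basis [CharZero k] (X : TwistedYD Φ) {l : ℕ}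
    (b : Module.Basis (Fin l) k X) (hcomp : ∀ g i, ∃ c : k, X.comp g (b i) = c • b i)
    (hact : ∀ g i, ∃ c : k, X.act g (b i) = c • b i) :
    X.IsNicholsGraded fun i => Submodule.span k {b i} := by
  have hp : ∀ i : ℕ, ((Nat.nth Nat.Prime i : ℕ) : k) ≠ 0 := fun i =>
    Nat.cast_ne_zero.2 (Nat.prime_nth_prime i).ne_zero
  let f : X ≃ₗ[k] X := b.equiv (b.unitsSMul fun i => Units.mk0 _ (hp i)) (Equiv.refl _)
  have hfb : ∀ i, f (b i) = ((Nat.nth Nat.Prime i : ℕ) : k) • b i := fun i => by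
    simp [f, Module.Basis.unitsSMul_apply, Units.smul_def]
  have hf : IsHom X X f.toLinearMap := by
    constructor
    · intro g
      refine LinearMap.congr_fun (f := f.toLinearMap ∘ₗ X.comp g) (g := X.comp g ∘ₗ f.toLinearMap)
        (b.ext fun i => ?_)
      obtain ⟨c, hc⟩ := hcomp g i
      simp [hc, hfb, smul_comm c]
    · intro g
      refine LinearMap.congr_fun (f := f.toLinearMap ∘ₗ X.act g) (g := X.act g ∘ₗ f.toLinearMap)
        (b.ext fun i => ?_)
      obtain ⟨c, hc⟩ := hact g i
      simp [hc, hfb, smul_comm c]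
  refine ⟨?_, X.iSup_nicholsDegree ?_⟩
  · refine ((Module.End.eigenspaces_iSupIndep
      (nicholsEquiv (IsPullback.id Φ) hf.isRes).toLinearMap).comp
      (prod_prime_zpow_injective k l)).mono fun d => ?_
    refine nicholsDegree_le_eigenspace hf.isRes (fun i => hp i) (fun i x hx => ?_) d
    obtain ⟨c, rfl⟩ := Submodule.mem_span_singleton.1 hx
    rw [map_smul, hfb, smul_comm]
  · rw [← Submodule.span_range_eq_iSup, b.span_eq]

/-! ### Simple objects and joint eigenvectors -/

/-- Joint generalized eigenspaces of commuting operators span over an algebraically closed field;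
semisimplicity turns them into genuine eigenspaces. -/
theorem span_joint_eigenvectors {K M ι : Type*} [Field K] [IsAlgClosed K] [AddCommGroup M]
    [Module K M] [FiniteDimensional K M] (f : ι → Module.End K M)
    (hc : ∀ i j, Commute (f i) (f j)) (hs : ∀ i, (f i).IsSemisimple) :
    Submodule.span K {v : M | ∀ i, ∃ c : K, f i v = c • v} = ⊤ := by
  have h := Module.End.iSup_iInf_maxGenEigenspace_eq_top_of_iSup_maxGenEigenspace_eq_top_of_commute
    f (fun i j _ => hc i j) (fun i => Module.End.iSup_maxGenEigenspace_eq_top (f i))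
  refine eq_top_iff.2 (h.symm.le.trans (iSup_le fun χ v hv => Submodule.subset_span fun i => ?_))
  refine ⟨χ i, ?_⟩
  have h1 := (Submodule.mem_iInf _).1 hv i
  rw [(hs i).isFinitelySemisimple.maxGenEigenspace_eq_eigenspace] at h1
  exact Module.End.mem_eigenspace_iff.1 h1

/-- The scalar is the same for all vectors of degree `g`. With `n` the order of `e`, the operator of
`e` satisfies a polynomial `X ^ n - c` there. -/
theorem act_pow (X : TwistedYD Φ) (g e : G) (n : ℕ) :
    ∃ c : kˣ, ∀ x, X.comp g x = x → (X.act e ^ n) x = (c : k) • X.act (e ^ n) x := by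
  induction n with
  | zero => exact ⟨1, fun x _ => by simp [X.act_one]⟩
  | succ n ih =>
    obtain ⟨c, hc⟩ := ih
    refine ⟨c * Φ.tilde g e (e ^ n), fun x hx => ?_⟩
    rw [pow_succ' (X.act e), Module.End.mul_apply, hc x hx, map_smul, ← hx, X.act_act, smul_smul,
      pow_succ', Units.val_mul]

theorem act_comm (X : TwistedYD Φ) (hΦ : ∀ g e f, Φ.tilde g e f = Φ.tilde g f e) (g e f : G)
    (x : X) (hx : X.comp g x = x) : X.act e (X.act f x) = X.act f (X.act e x) := by
  rw [← hx, X.act_act, X.act_act, hΦ, mul_comm]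

/-- If the `2`-cocycles `Φ̃_g` are symmetric, then a finite-dimensional homogeneous subspace which is
stable under the action is spanned by joint eigenvectors. -/
theorem le_span_eigenvectors [IsAlgClosed k] [CharZero k] (X : TwistedYD Φ)
    (hΦ : ∀ g e f, Φ.tilde g e f = Φ.tilde g f e) (S : Submodule k X) [FiniteDimensional k S] (g : G)
    (hg : ∀ x ∈ S, X.comp g x = x) (hS : ∀ e, ∀ x ∈ S, X.act e x ∈ S) :
    S ≤ Submodule.span k {x | x ∈ S ∧ ∀ e, ∃ c : k, X.act e x = c • x} := by
  let f : G → Module.End k S := fun e => (X.act e).restrict (hS e)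
  have hpow : ∀ e n, ∀ x : S, ((f e ^ n) x : X) = (X.act e ^ n) x := by
    intro e n x
    induction n with
    | zero => rfl
    | succ n ih =>
      rw [pow_succ', pow_succ', Module.End.mul_apply, Module.End.mul_apply, ← ih]
      rfl
  have h := span_joint_eigenvectors f
    (fun e e' => LinearMap.ext fun x => Subtype.ext (X.act_comm hΦ g e e' x (hg x x.2)))
    (fun e => by
      obtain ⟨c, hc⟩ := X.act_pow g e (orderOf e)
      have hn : (orderOf e : k) ≠ 0 := Nat.cast_ne_zero.2 (orderOf_pos e).ne'
      -- The polynomial `X ^ n - c` is separable, as `c` and the image of `n` in `k` are nonzero.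
      refine Module.End.isSemisimple_of_squarefree_aeval_eq_zero
        (Polynomial.separable_X_pow_sub_C (c : k) hn c.ne_zero).squarefree ?_
      refine LinearMap.ext fun x => Subtype.ext ?_
      simp only [map_sub, map_pow, Polynomial.aeval_X, Polynomial.aeval_C, LinearMap.sub_apply,
        Submodule.coe_sub, hpow, hc x (hg x x.2), pow_orderOf_eq_one, X.act_one]
      simp)
  have h2 : S = (⊤ : Submodule k S).map S.subtype := by
    rw [Submodule.map_top, Submodule.range_subtype]
  conv_lhs => rw [h2, ← h, Submodule.map_span]
  refine Submodule.span_mono ?_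
  rintro _ ⟨x, hx, rfl⟩
  refine ⟨x.2, fun e => ?_⟩
  obtain ⟨c, hc⟩ := hx e
  exact ⟨c, congrArg Subtype.val hc⟩

theorem IsSimpleSub.exists_degree {X : TwistedYD Φ} {S : Submodule k X} (hS : X.IsSimpleSub S) :
    ∃ g, ∀ x ∈ S, X.comp g x = x := by
  obtain ⟨⟨hc, ha⟩, hne, hmin⟩ := hS
  obtain ⟨x, hx, hx0⟩ := Submodule.exists_mem_ne_zero_of_ne_bot hne
  obtain ⟨g, hg⟩ : ∃ g, X.comp g x ≠ 0 := by
    by_contra! h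
    exact hx0 (by rw [← X.sum_comp x]; exact Finset.sum_eq_zero fun g _ => h g)
  -- The part of `S` in degree `g` is a nonzero subobject, hence all of `S`.
  have key : S ⊓ LinearMap.eqLocus (X.comp g) LinearMap.id = S := by
    refine (hmin _ ⟨?_, ?_⟩ inf_le_left).resolve_left fun h => hg ?_
    · rintro f y ⟨hy, hy'⟩
      refine ⟨hc f y hy, ?_⟩
      change X.comp g y = y at hy'
      change X.comp g (X.comp f y) = X.comp f y
      by_cases hgf : g = f
      · rw [hgf, X.comp_self]
      · rw [X.comp_ne g f y hgf, ← hy', X.comp_ne f g y (Ne.symm hgf)]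
    · rintro e y ⟨hy, hy'⟩
      change X.comp g y = y at hy'
      refine ⟨ha e y hy, ?_⟩
      change X.comp g (X.act e y) = X.act e y
      rw [X.comp_act, hy']
    · rw [← Submodule.mem_bot k, ← h]
      exact ⟨hc g x hx, X.comp_self g x⟩
  refine ⟨g, fun y hy => ?_⟩
  rw [← key] at hy
  exact hy.2

/-- The translates of a nonzero vector under the finite group `G` span a subobject, so they span
`S`. -/
theorem IsSimpleSub.finiteDimensional {X : TwistedYD Φ} {S : Submodule k X}
    (hS : X.IsSimpleSub S) : FiniteDimensional k S := by
  obtain ⟨g, hg⟩ := hS.exists_degree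
  obtain ⟨⟨hc, ha⟩, hne, hmin⟩ := hS
  obtain ⟨x, hx, hx0⟩ := Submodule.exists_mem_ne_zero_of_ne_bot hne
  have hle : Submodule.span k (Set.range fun e => X.act e x) ≤ S :=
    Submodule.span_le.2 (by rintro _ ⟨e, rfl⟩; exact ha e x hx)
  have key : Submodule.span k (Set.range fun e => X.act e x) = S := by
    refine (hmin _ ⟨fun f y hy => ?_, fun e y hy => ?_⟩ hle).resolve_left fun h => hx0 ?_
    · by_cases hgf : f = g
      · rw [hgf, hg y (hle hy)]
        exact hy
      · rw [← hg y (hle hy), X.comp_ne f g y hgf]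
        exact zero_mem _
    · refine (Submodule.span_le (p := (Submodule.span k (Set.range fun e => X.act e x)).comap
        (X.act e))).2 ?_ hy
      rintro _ ⟨f, rfl⟩
      change X.act e (X.act f x) ∈ Submodule.span k (Set.range fun e => X.act e x)
      rw [← hg x hx, X.act_act]
      exact Submodule.smul_mem _ _ (Submodule.subset_span ⟨e * f, by rw [hg x hx]⟩)
    · rw [← Submodule.mem_bot k, ← h]
      exact Submodule.subset_span ⟨1, X.act_one x⟩
  rw [← key]
  exact FiniteDimensional.span_of_finite k (Set.finite_range _)

theorem isSub_span_singleton {X : TwistedYD Φ} {x : X} (hcomp : ∀ g, ∃ c : k, X.comp g x = c • x)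
    (hact : ∀ e, ∃ c : k, X.act e x = c • x) : X.IsSub (Submodule.span k {x}) := by
  constructor
  · intro g y hy
    obtain ⟨a, rfl⟩ := Submodule.mem_span_singleton.1 hy
    obtain ⟨c, hc⟩ := hcomp g
    rw [map_smul, hc]
    exact Submodule.smul_mem _ _ (Submodule.smul_mem _ _ (Submodule.mem_span_singleton_self x))
  · intro g y hy
    obtain ⟨a, rfl⟩ := Submodule.mem_span_singleton.1 hy
    obtain ⟨c, hc⟩ := hact g
    rw [map_smul, hc]
    exact Submodule.smul_mem _ _ (Submodule.smul_mem _ _ (Submodule.mem_span_singleton_self x))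

theorem exists_comp_smul {X : TwistedYD Φ} {x : X} {g : G} (hx : X.comp g x = x) (f : G) :
    ∃ c : k, X.comp f x = c • x := by
  by_cases h : f = g
  · exact ⟨1, by rw [h, hx, one_smul]⟩
  · exact ⟨0, by rw [← hx, X.comp_ne f g x h, zero_smul]⟩

/-- A cocycle with symmetric `2`-cocycles `Φ̃_g` is abelian. -/
theorem _root_.QuasiNichols.Cocycle3.isAbelian_of_tilde_comm [IsAlgClosed k] [CharZero k]
    (hΦ : ∀ g e f, Φ.tilde g e f = Φ.tilde g f e) : Φ.IsAbelian := by
  intro X hX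
  obtain ⟨g, hg⟩ := IsSimpleSub.exists_degree hX
  have := IsSimpleSub.finiteDimensional hX
  have h := X.le_span_eigenvectors hΦ ⊤ g hg fun _ _ _ => Submodule.mem_top
  obtain ⟨x, hx, hx0⟩ : ∃ x : X, (∀ e, ∃ c : k, X.act e x = c • x) ∧ x ≠ 0 := by
    by_contra! h0
    refine hX.2.1 (eq_bot_iff.2 (h.trans (Submodule.span_le.2 ?_)))
    rintro x ⟨-, hx⟩
    exact h0 x hx
  have hsub := isSub_span_singleton (exists_comp_smul (hg x Submodule.mem_top)) hx
  rcases hX.2.2 _ hsub le_top with h1 | h1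
  · exact absurd (Submodule.span_singleton_eq_bot.1 h1) hx0
  · rw [← finrank_top, ← h1, finrank_span_singleton hx0]

/-! ### Restriction to the support group -/

theorem comp_eq_zero_of_notMem (V : TwistedYD Φ) {g : G} (hg : g ∉ V.supportGroup) :
    V.comp g = 0 := by
  by_contra h
  exact hg (Subgroup.subset_closure h)

/-- The object `V`, considered over its support group. -/
def restrictSupport (V : TwistedYD Φ) : TwistedYD (Φ.restrict V.supportGroup) where
  carrier := V
  comp g := V.comp g
  comp_self g v := V.comp_self g v
  comp_ne g h v hgh := V.comp_ne g h v fun e => hgh (Subtype.ext e)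
  sum_comp v := by
    refine (Fintype.sum_of_injective (Subtype.val : V.supportGroup → G) Subtype.val_injective _
      (fun g => V.comp g v) (fun g hg => ?_) fun _ => rfl).trans (V.sum_comp v)
    rw [V.comp_eq_zero_of_notMem fun h => hg ⟨⟨g, h⟩, rfl⟩, LinearMap.zero_apply]
  act g := V.act g
  act_one v := V.act_one v
  comp_act e g v := V.comp_act e g v
  act_act e f g v := V.act_act e f g v

theorem isPullback_restrict (Φ : Cocycle3 k G) (H : Subgroup G) :
    IsPullback H.subtype Φ (Φ.restrict H) :=
  ⟨Subtype.val_injective, fun _ _ _ => rfl⟩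

/-- The identity map from `V` to its restriction. -/
def toRestrictSupport (V : TwistedYD Φ) : V ≃ₗ[k] V.restrictSupport := LinearEquiv.refl k V.carrier

theorem isRes_restrictSupport (V : TwistedYD Φ) : IsRes V.supportGroup.subtype V V.restrictSupport
    V.toRestrictSupport.toLinearMap where
  comp _ _ := rfl
  supp g hg x := by
    rw [V.comp_eq_zero_of_notMem fun h => hg ⟨⟨g, h⟩, rfl⟩]
    rfl
  act _ _ := rfl

/-- Every degree of `V` is the degree of a simple summand, so at most two elements generate the
support group. Here the bound on the number of summands enters. -/
theorem tilde_restrict_comm (V : TwistedYD Φ) {m : ℕ} (hm : m ≤ 2) {S : Fin m → Submodule k V}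
    (hS : V.IsDirectSum S) (hsimple : ∀ i, V.IsSimpleSub (S i)) (x y z : V.supportGroup) :
    (Φ.restrict V.supportGroup).tilde x y z = (Φ.restrict V.supportGroup).tilde x z y := by
  choose d hd using fun i => (hsimple i).exists_degree
  have hsupp : ∀ g, V.comp g ≠ 0 → ∃ i, d i = g := by
    intro g hg
    by_contra! h
    refine hg (LinearMap.ker_eq_top.1 (eq_top_iff.2 (hS.2.symm.le.trans (iSup_le fun i v hv => ?_))))
    rw [LinearMap.mem_ker, ← hd i v hv, V.comp_ne _ _ _ (h i).symm]
  obtain ⟨a, b, hab⟩ : ∃ a b : G, ∀ i, d i ∈ ({a, b} : Set G) := by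
    interval_cases m
    · exact ⟨1, 1, fun i => i.elim0⟩
    · exact ⟨d 0, d 0, fun i => by rw [Subsingleton.elim i 0]; simp⟩
    · exact ⟨d 0, d 1, fun i => by fin_cases i <;> simp⟩
  have hle : V.supportGroup ≤ Subgroup.closure {a, b} :=
    Subgroup.closure_mono fun g hg => by
      obtain ⟨i, rfl⟩ := hsupp g hg
      exact hab i
  exact Φ.tilde_comm_of_alt (Φ.alt_eq_one (hle x.2) (hle y.2) (hle z.2))

/-- A direct sum of simple objects has a basis of homogeneous joint eigenvectors for the action of
the support group, which is adapted to the decomposition. -/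
theorem exists_eigenbasis [IsAlgClosed k] [CharZero k] (V : TwistedYD Φ) {m : ℕ}
    {S : Fin m → Submodule k V} (hS : V.IsDirectSum S) (hsimple : ∀ i, V.IsSimpleSub (S i))
    (hΦ : ∀ x y z, (Φ.restrict V.supportGroup).tilde x y z =
      (Φ.restrict V.supportGroup).tilde x z y) :
    ∃ (l : ℕ) (b : Module.Basis (Fin l) k V), (∀ i, ∃ j, b i ∈ S j) ∧
      (∀ i, ∃ g, V.comp g (b i) = b i) ∧
      ∀ i, ∀ e ∈ V.supportGroup, ∃ c : k, V.act e (b i) = c • b i := by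
  have hfin : ∀ i, FiniteDimensional k (S i) := fun i => (hsimple i).finiteDimensional
  have hV : FiniteDimensional k V := by
    have : FiniteDimensional k (iSup S : Submodule k V) := Submodule.finiteDimensional_iSup S
    rw [hS.2] at this
    exact Module.finite_def.2 ((Submodule.fg_top _).1 (Module.finite_def.1 this))
  choose d hd using fun i => (hsimple i).exists_degree
  let E : Set V := {v | (∃ j, v ∈ S j) ∧ (∃ g, V.comp g v = v) ∧
    ∀ e ∈ V.supportGroup, ∃ c : k, V.act e v = c • v}
  have hE : Submodule.span k E = ⊤ := by
    refine eq_top_iff.2 (hS.2.symm.le.trans (iSup_le fun i => ?_))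
    have hdi : d i ∈ V.supportGroup := by
      refine Subgroup.subset_closure fun h => (hsimple i).2.1 (eq_bot_iff.2 fun v hv => ?_)
      rw [← hd i v hv, h]
      simp
    -- Over `G` the summand may be simple of larger dimension; it splits into lines only when viewed
    -- over the support group.
    let S' : Submodule k V.restrictSupport := S i
    have : FiniteDimensional k S' := hfin i
    have h := V.restrictSupport.le_span_eigenvectors hΦ S' ⟨d i, hdi⟩ (hd i)
      fun e x hx => (hsimple i).1.2 e x hx
    refine h.trans (Submodule.span_mono ?_)
    rintro v ⟨hv, hact⟩
    exact ⟨⟨i, hv⟩, ⟨d i, hd i v hv⟩, fun e he => hact ⟨e, he⟩⟩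
  -- A basis chosen inside the spanning set `E` consists of eigenvectors and is adapted to the
  -- summands.
  obtain ⟨t, htE, hspan, hind⟩ := exists_linearIndependent k E
  have hfint : Finite t := hind.finite
  let b₀ : Module.Basis t k V := Module.Basis.mk hind (by
    rw [Subtype.range_coe, hspan, hE])
  let b := b₀.reindex (Finite.equivFin t)
  have hb : ∀ i, b i ∈ E := fun i => by
    simp only [b, b₀, Module.Basis.reindex_apply, Module.Basis.mk_apply]
    exact htE (Subtype.coe_prop _)
  exact ⟨_, b, fun i => (hb i).1, fun i => (hb i).2.1, fun i => (hb i).2.2⟩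

theorem isDirectSum_span_basis (V : TwistedYD Φ) {ι : Type*} (b : Module.Basis ι k V) :
    V.IsDirectSum fun i => Submodule.span k {b i} :=
  ⟨b.linearIndependent.iSupIndep_span_singleton, by
    rw [← Submodule.span_range_eq_iSup, b.span_eq]⟩

theorem isSimpleSub_span_singleton {V : TwistedYD Φ} {x : V} (hx : x ≠ 0)
    (h : V.IsSub (Submodule.span k {x})) : V.IsSimpleSub (Submodule.span k {x}) :=
  have ha := nonzero_span_atom (K := k) x hx
  ⟨h, ha.1, fun _ _ hle => ha.le_iff.1 hle⟩

/-- A direct sum of at most two simple objects has an abelian restriction of the cocycle to its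
support group, and the restriction of the object has an isomorphic Nichols algebra. -/
theorem isAbelian_and_nicholsIso [IsAlgClosed k] [CharZero k] (V : TwistedYD Φ) {m : ℕ}
    (hm : m ≤ 2) {S : Fin m → Submodule k V} (hS : V.IsDirectSum S)
    (hsimple : ∀ i, V.IsSimpleSub (S i)) :
    (Φ.restrict V.supportGroup).IsAbelian ∧ V.restrictSupport.IsDiagonal ∧
      V.NicholsIso V.restrictSupport := by
  have hΦ := V.tilde_restrict_comm hm hS hsimple
  obtain ⟨l, b, hbS, hbc, hba⟩ := V.exists_eigenbasis hS hsimple hΦ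
  let b' : Module.Basis (Fin l) k V.restrictSupport := b
  have hb0 : ∀ i, b i ≠ 0 := b.ne_zero
  have hcomp : ∀ (g : V.supportGroup) i, ∃ c : k, V.restrictSupport.comp g (b' i) = c • b' i := by
    intro g i
    obtain ⟨f, hf⟩ := hbc i
    exact exists_comp_smul hf g
  have hact : ∀ (g : V.supportGroup) i, ∃ c : k, V.restrictSupport.act g (b' i) = c • b' i :=
    fun g i => hba i g g.2
  have hsub : ∀ i, V.restrictSupport.IsSub (Submodule.span k {b' i}) := fun i =>
    isSub_span_singleton (fun g => hcomp g i) (fun g => hact g i)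
  have hsum := V.restrictSupport.isDirectSum_span_basis b'
  have hrank : ∀ i, Module.finrank k (Submodule.span k {b' i}) = 1 := fun i =>
    finrank_span_singleton (hb0 i)
  have hgr := V.restrictSupport.isNicholsGraded_of_basis b' hcomp hact
  have hj := isPullback_restrict Φ V.supportGroup
  have hf := V.isRes_restrictSupport
  have hdeg : ∀ d, (V.nicholsDegree (fun i => Submodule.span k {b i}) d).map
      (nicholsEquiv hj hf).toLinearMap =
        V.restrictSupport.nicholsDegree (fun i => Submodule.span k {b' i}) d := fun d => by
    rw [nicholsDegree_map]
    congr 1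
    exact funext fun i => Submodule.map_id _
  refine ⟨Cocycle3.isAbelian_of_tilde_comm hΦ,
    -- The lift puts the index type in the universe that `IsDiagonal` asks for.
    ⟨ULift (Fin l), fun i => Submodule.span k {b' i.down}, ?_, fun i => ⟨hsub _, hrank _⟩⟩,
    l, fun i => Submodule.span k {b i}, fun i => Submodule.span k {b' i},
    ⟨V.isDirectSum_span_basis b, fun i => finrank_span_singleton (hb0 i), m, S, hS, hsimple,
      fun i => (hbS i).imp fun j hj => (Submodule.span_singleton_le_iff_mem _ _).2 hj⟩,
    ⟨hsum, hrank, l, _, hsum, fun i => isSimpleSub_span_singleton (hb0 i) (hsub i),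
      fun i => ⟨i, le_rfl⟩⟩,
    ⟨?_, V.iSup_nicholsDegree (V.isDirectSum_span_basis b).2⟩, hgr,
    nicholsEquiv hj hf, nicholsEquiv_mul hj hf, nicholsEquiv_comul hj hf, hdeg⟩
  · have h := V.restrictSupport.isDirectSum_span_basis (b'.reindex Equiv.ulift.symm)
    simpa using h
  -- Independence in `B(V)` is taken from `B(V')`: the scaling automorphism need not commute with
  -- the action of `G` on `V`, so it is not used there directly.
  · rw [← iSupIndep_map_orderIso_iff (Submodule.orderIsoMapComap (nicholsEquiv hj hf))]
    have h := hgr.1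
    rw [← funext hdeg] at h
    exact h

end TwistedYD

end QuasiNichols

end

theorem propositionp4p19 {k : Type u} [Field k] [IsAlgClosed k] [CharZero k]
    {G : Type w} [CommGroup G] [Finite G] (Φ : QuasiNichols.Cocycle3 k G)
    (V : QuasiNichols.TwistedYD Φ) (hV : V.IsSimple ∨ V.IsSumOfTwoSimples) :
    (Φ.restrict V.supportGroup).IsAbelian ∧
      ∃ V' : QuasiNichols.TwistedYD (Φ.restrict V.supportGroup),
        V'.IsDiagonal ∧ V.NicholsIso V' := by
  rcases hV with hV | ⟨S, hS, hsimple⟩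
  -- A simple object is treated as a decomposition with a single summand.
  · have h := V.isAbelian_and_nicholsIso (m := 1) (by norm_num) (S := fun _ => ⊤)
      ⟨iSupIndep_subsingleton _, iSup_const⟩ fun _ => hV
    exact ⟨h.1, _, h.2⟩
  · have h := V.isAbelian_and_nicholsIso le_rfl hS hsimple
    exact ⟨h.1, _, h.2⟩
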